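/- All graphs are finite and simple. A graph $G$ is $t$-chromatic if its chromatic number $\chi(G)$ equals $t$. A connected graph $G$ is double-critical if $\chi(G\setminus\{x,y\})=\chi(G)-2$ for every edge $xy$ of $G$, where $G\setminus\{x,y\}$ is the subgraph of $G$ induced on $V(G)\setminus\{x,y\}$. A graph is claw-free if it does not contain $K_{1,3}$ as an induced subgraph. Theorem. Let $G$ be a double-critical, $t$-chromatic graph with $t\le 8$ (in particular, $t$ may be $6$, $7$ or $8$). If $G$ is claw-free, then $G$ is isomorphic to the complete graph $K_t$. That is, the Double-Critical Graph Conjecture (every double-critical, $t$-chromatic graph is isomorphic to $K_t$) holds for claw-free graphs with chromatic number at most $8$. -/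

import Mathlib

namespace SimpleGraph

/-- A graph is double-critical if it is connected and deleting the two ends of any edge lowers the
chromatic number by exactly two.  (The equation is written additively, so that no truncated
subtraction occurs.) -/
def IsDoubleCritical {V : Type*} (G : SimpleGraph V) : Prop :=
  G.Connected ∧
    ∀ x y : V, G.Adj x y →
      (G.induce ({x, y}ᶜ : Set V)).chromaticNumber + 2 = G.chromaticNumber

/-- A graph is claw-free if it does not contain `K_{1,3}` as an induced subgraph. -/
def IsClawFree {V : Type*} (G : SimpleGraph V) : Prop :=
  ¬ (completeBipartiteGraph (Fin 1) (Fin 3)).IsIndContained G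

end SimpleGraph

/-!
# Claw-free double-critical graphs with chromatic number at most eight are complete

A `State` is a proper colouring with as many colours as the chromatic number and two singleton
classes. Degree considerations reduce the problem to graphs with chromatic number eight that are
regular of degree ten. There, a `Flex` clique is one on which the singleton classes can be moved
freely; such a clique never has three vertices or more, so the single colours at both ends of a
state are disjoint, and these then give a clique with seven vertices, which is too large.
-/

/-! An edge `xy` has a `t`-colouring in which `x` and `y` are singleton classes. Since no proper
colouring saves a colour, recolourings along short Kempe chains must fail. Hence `x` and `y` have a
common neighbour in every other colour (`exists_common`), and any two other colours occur in order
on a path of length three from `x` to `y` (`exists_path`). If a colour occurs only once near an end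
(a single colour), its vertex can take over as the singleton (`State.move`).

Universal vertices can be removed together with their colours. Every neighbourhood then needs at
most `t - 3` colours, because it misses an edge, and by claw-freeness it uses each colour at most
twice. So degrees are at most `2t - 6` and cliques have at most `t - 2` vertices. Common neighbours
give degree at least `t + 1`, and a study of the non-edges in a neighbourhood excludes equality when
`t ≤ 8`. What remains is `t = 8` with all degrees ten.

There each end of a state has three single colours. If one is single for both ends, the singletons
can be placed at any two vertices of a triangle; such flexible cliques are excluded for sizes six,
five, four and three in turn, each size relying on the next larger one. So the two triples of single
colours are disjoint. Their vertices, together with one end, form a clique with seven vertices, one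
more than allowed. -/

namespace DoubleCritical

open Finset
open scoped Classical

/-! ### Recolouring around two singleton classes. -/

variable {V C : Type*}

/-- A proper colouring, as a bare function. -/
def Proper (G : SimpleGraph V) (f : V → C) : Prop := ∀ ⦃u v⦄, G.Adj u v → f u ≠ f v

/-- A proper colouring in which `x` and `y` form singleton colour classes. -/
structure State (G : SimpleGraph V) (f : V → C) (x y : V) : Prop where
  proper : Proper G f
  ne : x ≠ y
  left : ∀ v, f v = f x → v = x
  right : ∀ v, f v = f y → v = y

/-- The working form of "double-critical and claw-free with chromatic number `|C|`". -/
structure PreCrit (G : SimpleGraph V) (C : Type*) : Prop where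
  surj : ∀ f : V → C, Proper G f → Function.Surjective f
  state : ∀ ⦃x y⦄, G.Adj x y → ∃ f : V → C, State G f x y
  claw : ∀ ⦃v a b c⦄, G.Adj v a → G.Adj v b → G.Adj v c → a ≠ b → a ≠ c → b ≠ c →
    ¬ G.Adj a b → ¬ G.Adj a c → G.Adj b c
  noniso : ∀ v, ∃ w, G.Adj v w

/-- In addition, no vertex is adjacent to all others. -/
structure Crit (G : SimpleGraph V) (C : Type*) : Prop extends PreCrit G C where
  nonuniv : ∀ v, ∃ w, w ≠ v ∧ ¬ G.Adj v w

variable {G : SimpleGraph V} {f : V → C} {x y : V}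

theorem State.symm (s : State G f x y) : State G f y x :=
  ⟨s.proper, s.ne.symm, s.right, s.left⟩

theorem State.color_ne (s : State G f x y) : f x ≠ f y := fun h => s.ne (s.right x h)

/-- Otherwise `x` could join the class of `y`, and the colour of `x` would no longer be used. -/
theorem PreCrit.adj (h : PreCrit G C) (s : State G f x y) : G.Adj x y := by
  by_contra hn
  obtain ⟨v, hv⟩ := h.surj (fun v => if v = x then f y else f v) (by
    intro u v huv
    have h1 := s.proper huv
    have h2 := s.right u
    have h3 := s.right v
    have h4 := huv.symm
    have h5 := huv.ne
    grind) (f x)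
  have h1 := s.left v
  have h2 := s.color_ne
  grind

/-- If there were none, `x` could take colour `j` and its neighbours of colour `j` the colour of
`y`; the old colour of `x` would be lost. -/
theorem PreCrit.exists_common (h : PreCrit G C) (s : State G f x y) {j : C} (hx : j ≠ f x)
    (hy : j ≠ f y) : ∃ v, G.Adj x v ∧ G.Adj y v ∧ f v = j := by
  by_contra! hn
  obtain ⟨v, hv⟩ := h.surj
    (fun v => if v = x then j else if G.Adj x v ∧ f v = j then f y else f v) (by
    intro u v huv
    have h1 := s.proper huv
    have h2 := s.right u
    have h3 := s.right v
    have h4 := huv.symm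
    have h5 := huv.ne
    have h6 := hn u
    have h7 := hn v
    grind) (f x)
  have h1 := s.left v
  have h2 := s.color_ne
  grind

/-- The Kempe shift one step longer: `x` takes `j`, its neighbours of colour `j` (the set `A`) take
`k`, and their neighbours of colour `k` (the set `B`) take the colour of `y`. Only a vertex of `B`
adjacent to `y` can obstruct this. -/
theorem PreCrit.exists_path (h : PreCrit G C) (s : State G f x y) {j k : C} (hjx : j ≠ f x)
    (hjy : j ≠ f y) (hkx : k ≠ f x) (hky : k ≠ f y) (hjk : j ≠ k) :
    ∃ v w, G.Adj x v ∧ G.Adj v w ∧ G.Adj y w ∧ f v = j ∧ f w = k := by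
  by_contra! hn
  let A : V → Prop := fun v => G.Adj x v ∧ f v = j
  let B : V → Prop := fun w => f w = k ∧ ∃ v, A v ∧ G.Adj v w
  have hB : ∀ w, B w → ¬ G.Adj y w := by
    rintro w ⟨hw, v, ⟨hv, hvj⟩, hvw⟩ hyw
    exact hn v w hv hvw hyw hvj hw
  have hAB : ∀ v w, A v → G.Adj v w → f w = k → B w := fun v w hv hvw hw => ⟨hw, v, hv, hvw⟩
  have hA : ∀ v, A v ↔ G.Adj x v ∧ f v = j := fun v => Iff.rfl
  have hBk : ∀ w, B w → f w = k := fun w hw => hw.1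
  clear_value A B
  obtain ⟨v, hv⟩ := h.surj
    (fun v => if v = x then j else if A v then k else if B v then f y else f v) (by
    intro u v huv
    have h1 := s.proper huv
    have h2 := s.right u
    have h3 := s.right v
    have h4 := huv.symm
    have h5 := huv.ne
    have h6 := hA u
    have h7 := hA v
    have h8 := hAB u v
    have h9 := hAB v u
    have h10 := hB u
    have h11 := hB v
    have h12 := hBk u
    have h13 := hBk v
    clear hA hB hAB hBk hn
    dsimp only
    split_ifs <;> grind) (f x)
  have h1 := s.left v
  have h2 := s.color_ne
  have h3 := hA v
  have h4 := hBk v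
  clear hn hA hB hAB hBk
  grind

/-- If `a` is the only neighbour of `x` in its colour class, `x` and `a` may exchange colours. -/
theorem State.move (s : State G f x y) {a : V} (hay : f a ≠ f y) (hxa : a ≠ x)
    (ha : ∀ z, G.Adj x z → f z = f a → z = a) : State G (f ∘ Equiv.swap x a) a y := by
  have e : ∀ z, (f ∘ Equiv.swap x a) z = if z = x then f a else if z = a then f x else f z := by
    intro z
    simp only [Function.comp, Equiv.swap_apply_def]
    split_ifs <;> rfl
  refine ⟨?_, ?_, ?_, ?_⟩
  · intro u v huv
    rw [e, e]
    have h1 := s.proper huv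
    have h2 := s.left u
    have h3 := s.left v
    have h4 := huv.symm
    have h5 := huv.ne
    have h6 := ha u
    have h7 := ha v
    clear e
    split_ifs <;> grind
  · rintro rfl; exact hay rfl
  · intro v hv
    rw [e, e] at hv
    have := s.left v
    have := s.left a
    clear e
    grind
  · intro v hv
    rw [e, e] at hv
    have := s.right v
    have := s.left y
    have := s.ne
    have := s.color_ne
    clear e
    grind

theorem move_apply {a : V} (z : V) :
    (f ∘ Equiv.swap x a) z = if z = x then f a else if z = a then f x else f z := by
  simp only [Function.comp, Equiv.swap_apply_def]
  split_ifs <;> rfl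

/-! ### Colours in a neighbourhood; bounds for cliques and degrees. -/

theorem PreCrit.exists_edge_outside (h : PreCrit G C) (x : V) :
    ∀ w, w ≠ x → ¬ G.Adj x w → ∃ b, b ≠ x ∧ ¬ G.Adj x b ∧ G.Adj w b := by
  intro w hwx hxw
  obtain ⟨y, hy⟩ := h.noniso w
  by_cases hxy : G.Adj x y
  -- In a state at `wy`, the common neighbour of `w` and `y` with the colour of `x` cannot be
  -- adjacent to `x`.
  · obtain ⟨f, s⟩ := h.state hy
    obtain ⟨v, hv1, hv2, hv3⟩ := h.exists_common s (j := f x) (fun e => hwx (s.left x e).symm)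
      (fun e => hxy.ne (s.right x e))
    refine ⟨v, ?_, fun hxv => s.proper hxv hv3.symm, hv1⟩
    rintro rfl
    exact hxw hv1.symm
  · refine ⟨y, ?_, hxy, hy⟩
    rintro rfl
    exact hxw hy.symm

/-- An independent set in a neighbourhood has at most two elements. -/
theorem PreCrit.card_indep_le (h : PreCrit G C) {s : Finset V} (hs : ∀ z ∈ s, G.Adj x z)
    (hi : ∀ a ∈ s, ∀ b ∈ s, ¬ G.Adj a b) : s.card ≤ 2 := by
  by_contra! hc
  obtain ⟨a, b, c, ha, hb, hc, hab, hac, hbc⟩ := Finset.two_lt_card_iff.1 hc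
  exact hi b hb c hc (h.claw (hs a ha) (hs b hb) (hs c hc) hab hac hbc (hi a ha b hb) (hi a ha c hc))

/-- The neighbourhood of a vertex can be coloured with three colours less. -/
theorem Crit.exists_nbr_coloring [Fintype C] (h : Crit G C) (x : V) :
    ∃ (f : V → C) (D : Finset C), Proper G f ∧ D.card + 3 = Fintype.card C ∧
      ∀ z, G.Adj x z → f z ∈ D := by
  obtain ⟨a, hax, hxa⟩ := h.nonuniv x
  obtain ⟨b, hbx, hxb, hab⟩ := h.exists_edge_outside x a hax hxa
  obtain ⟨f, s⟩ := h.state hab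
  have h1 : f x ≠ f a := fun e => hax (s.left x e).symm
  have h2 : f x ≠ f b := fun e => hbx (s.right x e).symm
  refine ⟨f, ({f x, f a, f b} : Finset C)ᶜ, s.proper, ?_, ?_⟩
  · have h3 : ({f x, f a, f b} : Finset C).card = 3 := by
      rw [Finset.card_eq_three]; exact ⟨_, _, _, h1, h2, s.color_ne, rfl⟩
    have := Finset.card_add_card_compl ({f x, f a, f b} : Finset C)
    omega
  · intro z hz
    simp only [Finset.mem_compl, Finset.mem_insert, Finset.mem_singleton, not_or]
    refine ⟨(s.proper hz).symm, fun e => ?_, fun e => ?_⟩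
    · exact hxa (s.left z e ▸ hz)
    · exact hxb (s.right z e ▸ hz)

/-- A clique has at most `|C| - 2` vertices. -/
theorem Crit.card_clique_le [Fintype C] (h : Crit G C) {K : Finset V}
    (hK : ∀ u ∈ K, ∀ v ∈ K, u ≠ v → G.Adj u v) (hne : K.Nonempty) :
    K.card + 2 ≤ Fintype.card C := by
  obtain ⟨x, hx⟩ := hne
  obtain ⟨f, D, hf, hD, hz⟩ := h.exists_nbr_coloring x
  have h1 : (K.erase x).card ≤ D.card := by
    apply Finset.card_le_card_of_injOn f
    · intro z hzK
      have hzK := Finset.mem_coe.1 hzK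
      rw [Finset.mem_erase] at hzK
      exact hz z (hK x hx z hzK.2 hzK.1.symm)
    · intro u hu v hv huv
      by_contra hne
      exact hf (hK u (Finset.mem_of_mem_erase hu) v (Finset.mem_of_mem_erase hv) hne) huv
  have := Finset.card_erase_add_one hx
  omega

section Finite

variable [Fintype V]

/-- The neighbours of `x`. -/
noncomputable def nbr (G : SimpleGraph V) (x : V) : Finset V := univ.filter fun z => G.Adj x z

/-- The neighbours of `x` of colour `j`. -/
noncomputable def cnbr (G : SimpleGraph V) (f : V → C) (x : V) (j : C) : Finset V :=
  univ.filter fun z => G.Adj x z ∧ f z = j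

@[simp] theorem mem_nbr {z : V} : z ∈ nbr G x ↔ G.Adj x z := by simp [nbr]

@[simp] theorem mem_cnbr {z : V} {j : C} : z ∈ cnbr G f x j ↔ G.Adj x z ∧ f z = j := by
  simp [cnbr]

theorem PreCrit.card_cnbr_le (h : PreCrit G C) {K : Type*} {f : V → K} (hf : Proper G f) (x : V) (j : K) :
    (cnbr G f x j).card ≤ 2 := by
  apply h.card_indep_le (x := x)
  · simp +contextual
  · intro a ha b hb hab
    simp only [mem_cnbr] at ha hb
    exact hf hab (ha.2.trans hb.2.symm)

theorem card_nbr_eq_sum [Fintype C] (f : V → C) (x : V) :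
    (nbr G x).card = ∑ j, (cnbr G f x j).card := by
  rw [Finset.card_eq_sum_card_fiberwise (f := f) (t := univ) (by simp [Set.MapsTo])]
  refine Finset.sum_congr rfl fun j _ => ?_
  congr 1
  ext z
  simp

theorem Crit.card_nbr_le [Fintype C] (h : Crit G C) (x : V) :
    (nbr G x).card + 6 ≤ 2 * Fintype.card C := by
  obtain ⟨f, D, hf, hD, hz⟩ := h.exists_nbr_coloring x
  have : (nbr G x).card ≤ 2 * D.card := by
    apply Finset.card_le_mul_card_image_of_maps_to (f := f)
    · simpa using hz
    · intro j _
      refine le_trans (Finset.card_le_card ?_) (h.card_cnbr_le hf x j)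
      intro z; simp
  omega

/-- The ends of an edge have at least `|C| - 2` common neighbours. -/
theorem Crit.le_card_common [Fintype C] (h : Crit G C) (hxy : G.Adj x y) :
    Fintype.card C ≤ (nbr G x ∩ nbr G y).card + 2 := by
  obtain ⟨f, s⟩ := h.state hxy
  have h1 : ({f x, f y} : Finset C)ᶜ ⊆ (nbr G x ∩ nbr G y).image f := by
    intro j hj
    simp only [Finset.mem_compl, Finset.mem_insert, Finset.mem_singleton, not_or] at hj
    obtain ⟨v, h1, h2, h3⟩ := h.exists_common s hj.1 hj.2
    simp only [Finset.mem_image, Finset.mem_inter, mem_nbr]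
    exact ⟨v, ⟨h1, h2⟩, h3⟩
  have h2 := Finset.card_le_card h1
  have h3 := Finset.card_image_le (s := nbr G x ∩ nbr G y) (f := f)
  have h4 := Finset.card_add_card_compl ({f x, f y} : Finset C)
  have h5 := Finset.card_le_two (a := f x) (b := f y)
  omega

end Finite

end DoubleCritical

/-! ### Non-edges inside a neighbourhood and single colours. -/

namespace DoubleCritical

open Finset
open scoped Classical

variable {V C : Type*} {G : SimpleGraph V} {f : V → C} {x y : V}

/-- Two nonadjacent neighbours `y`, `z` of `x`: some common neighbour of `x` and `y` has the colour
of `z`. -/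
theorem Crit.exists_partner (h : Crit G C) (s : State G f x y) {z : V} (hz : G.Adj x z)
    (hyz : y ≠ z) : ∃ w, G.Adj x w ∧ G.Adj y w ∧ f w = f z :=
  h.exists_common s (s.proper hz).symm fun e => hyz (s.right z e).symm

/-- In the complement of a neighbourhood this excludes vertices of degree one: a vertex `z` that
misses `y` also misses the common neighbour of `x` and `y` sharing its colour. -/
theorem Crit.exists_second_nonadj (h : Crit G C) {z : V} (hy : G.Adj x y) (hz : G.Adj x z)
    (hyz : y ≠ z) (hn : ¬ G.Adj y z) : ∃ w, G.Adj x w ∧ G.Adj y w ∧ z ≠ w ∧ ¬ G.Adj z w := by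
  obtain ⟨f, s⟩ := h.state hy
  obtain ⟨w, h1, h2, h3⟩ := h.exists_partner s hz hyz
  refine ⟨w, h1, h2, ?_, fun e => s.proper e h3.symm⟩
  rintro rfl
  exact hn h2

/-- The path from `exists_path` with the colours of `a` and `b` has no choice but to pass through
`a` and `b`. -/
theorem Crit.adj_of_singles (h : Crit G C) (s : State G f x y) {a b : V}
    (ha : G.Adj x a) (ha' : ∀ z, G.Adj x z → f z = f a → z = a)
    (hb : G.Adj y b) (hb' : ∀ z, G.Adj y z → f z = f b → z = b)
    (hay : a ≠ y) (hbx : b ≠ x) (hab : f a ≠ f b) : G.Adj a b := by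
  obtain ⟨v, w, h1, h2, h3, h4, h5⟩ := h.exists_path s (s.proper ha).symm
    (fun e => hay (s.right a e)) (fun e => hbx (s.left b e)) (s.proper hb).symm hab
  rw [← ha' v h1 h4, ← hb' w h3 h5]
  exact h2

variable [Fintype V]

/-- The neighbours of `x` other than `y` that are not adjacent to `y`. -/
noncomputable def non (G : SimpleGraph V) (x y : V) : Finset V :=
  univ.filter fun z => G.Adj x z ∧ y ≠ z ∧ ¬ G.Adj y z

@[simp] theorem mem_non {z : V} : z ∈ non G x y ↔ G.Adj x z ∧ y ≠ z ∧ ¬ G.Adj y z := by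
  simp [non]

theorem card_non_add (hxy : G.Adj x y) :
    (non G x y).card + (nbr G x ∩ nbr G y).card + 1 = (nbr G x).card := by
  have h1 : nbr G x = insert y (non G x y ∪ (nbr G x ∩ nbr G y)) := by
    ext z
    simp only [mem_nbr, mem_insert, mem_union, mem_non, mem_inter]
    grind
  have h2 : Disjoint (non G x y) (nbr G x ∩ nbr G y) := by
    rw [Finset.disjoint_left]
    intro z
    simp +contextual
  have h3 : y ∉ non G x y ∪ (nbr G x ∩ nbr G y) := by simp
  conv_rhs => rw [h1]
  rw [Finset.card_insert_of_notMem h3, Finset.card_union_of_disjoint h2]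

theorem Crit.card_non_le [Fintype C] (h : Crit G C) (hxy : G.Adj x y) :
    (non G x y).card + Fintype.card C ≤ (nbr G x).card + 1 := by
  have := card_non_add hxy
  have := h.le_card_common hxy
  omega

theorem Crit.exists_nonadj [Fintype C] (h : Crit G C) (x : V) :
    ∃ y z, G.Adj x y ∧ G.Adj x z ∧ y ≠ z ∧ ¬ G.Adj y z := by
  by_contra! hn
  obtain ⟨y, hxy⟩ := h.noniso x
  have h1 := h.card_clique_le (K := insert x (nbr G x)) (by
    intro u hu v hv huv
    simp only [mem_insert, mem_nbr] at hu hv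
    rcases hu with rfl | hu <;> rcases hv with rfl | hv
    · exact absurd rfl huv
    · exact hv
    · exact hu.symm
    · exact hn u v hu hv huv) ⟨x, by simp⟩
  rw [Finset.card_insert_of_notMem (by simp)] at h1
  have := card_non_add hxy
  have := h.le_card_common hxy
  omega

/-- Some neighbour of `x` misses two others, while at least `|C| - 2` are common neighbours;
counting the vertex itself gives `|C| + 1`. -/
theorem Crit.lt_card_nbr [Fintype C] (h : Crit G C) (x : V) :
    Fintype.card C + 1 ≤ (nbr G x).card := by
  obtain ⟨y, z, hy, hz, hyz, hn⟩ := h.exists_nonadj x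
  obtain ⟨w, hw, hyw, hzw, hn'⟩ := h.exists_second_nonadj hy hz hyz hn
  have h1 : ({y, w} : Finset V) ⊆ non G x z := by
    intro u
    simp only [mem_insert, mem_singleton, mem_non]
    rintro (rfl | rfl)
    · exact ⟨hy, hyz.symm, fun e => hn e.symm⟩
    · exact ⟨hw, hzw, hn'⟩
  have h2 := Finset.card_le_card h1
  rw [Finset.card_pair hyw.ne] at h2
  have := h.card_non_le hz
  omega

theorem Crit.card_cnbr_pos (h : Crit G C) (s : State G f x y) {j : C} (hx : j ≠ f x)
    (hy : j ≠ f y) : 1 ≤ (cnbr G f x j).card := by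
  obtain ⟨v, h1, h2, h3⟩ := h.exists_common s hx hy
  exact Finset.card_pos.2 ⟨v, by simp [h1, h3]⟩

/-- The colours that occur exactly once in the neighbourhood of `x`, apart from that of `y`. -/
noncomputable def singles [Fintype C] (G : SimpleGraph V) (f : V → C) (x y : V) : Finset C :=
  univ.filter fun j => j ≠ f y ∧ (cnbr G f x j).card = 1

theorem State.card_cnbr_self (s : State G f x y) : (cnbr G f x (f x)).card = 0 := by
  rw [Finset.card_eq_zero, Finset.eq_empty_iff_forall_notMem]
  intro z hz
  simp only [mem_cnbr] at hz
  exact s.proper hz.1 hz.2.symm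

theorem Crit.card_cnbr_right (h : Crit G C) (s : State G f x y) :
    (cnbr G f x (f y)).card = 1 := by
  rw [Finset.card_eq_one]
  refine ⟨y, ?_⟩
  ext z
  simp only [mem_cnbr, mem_singleton]
  exact ⟨fun hz => s.right z hz.2, fun e => by subst e; exact ⟨h.adj s, rfl⟩⟩

/-- Every colour contributes two to the degree, except for a deficit of two at `f x`, one at `f y`,
and one at each single colour. -/
theorem Crit.card_singles [Fintype C] (h : Crit G C) (s : State G f x y) :
    (nbr G x).card + (singles G f x y).card + 3 = 2 * Fintype.card C := by
  have h1 : ∀ j : C, (cnbr G f x j).card + (if j ∈ singles G f x y then 1 else 0) +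
      ((if j = f x then 2 else 0) + (if j = f y then 1 else 0)) = 2 := by
    intro j
    by_cases hx : j = f x
    · subst hx
      simp [singles, s.card_cnbr_self, s.color_ne]
    by_cases hy : j = f y
    · subst hy
      simp [singles, h.card_cnbr_right s, s.color_ne.symm]
    have h2 := h.card_cnbr_pos s hx hy
    have h3 := h.card_cnbr_le s.proper x j
    simp only [singles, mem_filter, mem_univ, true_and, hx, hy, if_false]
    split_ifs with h4
    · simp [h4.2]
    · simp only [ne_eq, not_false_eq_true, true_and, hy] at h4
      omega
  have h2 := Finset.sum_congr (rfl : (univ : Finset C) = univ) fun j _ => h1 j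
  simp only [Finset.sum_add_distrib, Finset.sum_ite_eq', Finset.sum_const, Finset.mem_univ,
    if_true, Finset.card_univ, smul_eq_mul] at h2
  rw [← card_nbr_eq_sum, ← Finset.card_filter, Finset.filter_mem_eq_inter, Finset.univ_inter] at h2
  omega

/-- Neighbours of `x` that are adjacent to all others lower the bound on the degree of `x`. -/
theorem Crit.card_isolated_le [Fintype C] (h : Crit G C) (x : V) {I : Finset V}
    (hI : ∀ u ∈ I, G.Adj x u ∧ ∀ z, G.Adj x z → u ≠ z → G.Adj u z) :
    (nbr G x).card + I.card + 6 ≤ 2 * Fintype.card C := by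
  obtain ⟨g, D, hg, hD, hz⟩ := h.exists_nbr_coloring x
  -- A vertex of `I` is alone in its colour within the neighbourhood, so the other neighbours share
  -- the remaining colours of `D`, at most two to each.
  have h1 : ((nbr G x) \ I).card ≤ 2 * (D \ I.image g).card := by
    apply Finset.card_le_mul_card_image_of_maps_to (f := g)
    · intro z hzm
      simp only [mem_sdiff, mem_nbr, mem_image, not_exists, not_and] at hzm ⊢
      refine ⟨hz z hzm.1, fun u hu e => ?_⟩
      have : u ≠ z := fun e => hzm.2 (e ▸ hu)
      exact hg ((hI u hu).2 z hzm.1 this) e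
    · intro j _
      refine le_trans (Finset.card_le_card ?_) (h.card_cnbr_le hg x j)
      intro z; simp +contextual
  have h2 : I ⊆ nbr G x := fun u hu => by simpa using (hI u hu).1
  have h3 : I.image g ⊆ D := by
    intro j
    simp only [mem_image]
    rintro ⟨u, hu, rfl⟩
    exact hz u (hI u hu).1
  have h4 : (I.image g).card = I.card := by
    apply Finset.card_image_of_injOn
    intro u hu v hv e
    by_contra huv
    exact hg ((hI u hu).2 v (hI v hv).1 huv) e
  rw [Finset.card_sdiff_of_subset h2, Finset.card_sdiff_of_subset h3] at h1
  have := Finset.card_le_card h2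
  have := Finset.card_le_card h3
  omega

theorem Crit.exists_card_singles [Fintype C] (h : Crit G C) (s : State G f x y) :
    ∃ T : Finset V, T.card = (singles G f x y).card ∧
      ∀ t ∈ T, G.Adj x t ∧ G.Adj y t ∧ f t ∈ singles G f x y ∧
        ∀ z, G.Adj x z → f z = f t → z = t := by
  have h1 : ∀ j ∈ singles G f x y, ∃ t, G.Adj x t ∧ G.Adj y t ∧ f t = j := by
    intro j hj
    simp only [singles, mem_filter, mem_univ, true_and] at hj
    refine h.exists_common s ?_ hj.1
    rintro rfl
    simp [s.card_cnbr_self] at hj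
  have : Nonempty V := ⟨x⟩
  choose! t ht using h1
  refine ⟨(singles G f x y).image t, ?_, ?_⟩
  · apply Finset.card_image_of_injOn
    intro i hi j hj e
    rw [← (ht i hi).2.2, e, (ht j hj).2.2]
  · intro u hu
    rw [mem_image] at hu
    obtain ⟨j, hj, rfl⟩ := hu
    obtain ⟨h1, h2, h3⟩ := ht j hj
    refine ⟨h1, h2, h3.symm ▸ hj, fun z hz e => ?_⟩
    simp only [singles, mem_filter, mem_univ, true_and] at hj
    exact Finset.card_le_one.1 hj.2.le z (by simp [hz, e, h3]) _ (by simp [h1, h3])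

end DoubleCritical

/-! ### Degree `|C| + 1` is impossible. -/

namespace DoubleCritical

open Finset
open scoped Classical

variable {V C : Type*} {G : SimpleGraph V} {f : V → C} {x y : V} [Fintype V]

/-- At this degree the common-neighbour bound is tight, so the non-edges in the neighbourhood form
cycles plus isolated vertices. One of them turns out to be the five-cycle `y z₁ w₁ w₂ z₂`, and at
most one vertex is isolated. Three vertices are left; they must miss each other, which makes a claw
at `x`. -/
theorem Crit.card_nbr_ne [Fintype C] (h : Crit G C) (hC : Fintype.card C ≤ 8) (x : V) :
    (nbr G x).card ≠ Fintype.card C + 1 := by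
  intro hd
  -- in the complement of the neighbourhood, all degrees are zero or two
  have deg : ∀ a b c d, G.Adj x a → G.Adj x b → G.Adj x c → G.Adj x d → a ≠ b → a ≠ c → a ≠ d →
      ¬ G.Adj a b → ¬ G.Adj a c → ¬ G.Adj a d → b = c ∨ b = d ∨ c = d := by
    intro a b c d ha hb hc hd' hab hac had nab nac nad
    by_contra! hne
    have h1 : ({b, c, d} : Finset V) ⊆ non G x a := by
      intro u
      simp only [mem_insert, mem_singleton, mem_non]
      rintro (rfl | rfl | rfl) <;> simp_all
    have h2 := Finset.card_le_card h1
    rw [Finset.card_eq_three.2 ⟨b, c, d, hne.1, hne.2.1, hne.2.2, rfl⟩] at h2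
    have := h.card_non_le ha
    omega
  have sec : ∀ y z, G.Adj x y → G.Adj x z → y ≠ z → ¬ G.Adj y z →
      ∃ w, G.Adj x w ∧ G.Adj y w ∧ z ≠ w ∧ ¬ G.Adj z w := fun y z hy hz =>
    h.exists_second_nonadj hy hz
  obtain ⟨y, z₁, hy, hz₁, hyz₁, nyz₁⟩ := h.exists_nonadj x
  obtain ⟨z₂, hz₂, hzz, hyz₂, nyz₂⟩ := sec z₁ y hz₁ hy hyz₁.symm (fun e => nyz₁ e.symm)
  obtain ⟨f, s⟩ := h.state hy
  obtain ⟨w₁, hw₁, hyw₁, ew₁⟩ := h.exists_partner s hz₁ hyz₁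
  obtain ⟨w₂, hw₂, hyw₂, ew₂⟩ := h.exists_partner s hz₂ hyz₂
  have hzw₁ : z₁ ≠ w₁ := by rintro rfl; exact nyz₁ hyw₁
  have hzw₂ : z₂ ≠ w₂ := by rintro rfl; exact nyz₂ hyw₂
  have nzw₁ : ¬ G.Adj z₁ w₁ := fun e => s.proper e ew₁.symm
  have nzw₂ : ¬ G.Adj z₂ w₂ := fun e => s.proper e ew₂.symm
  have ezz : f z₁ ≠ f z₂ := s.proper hzz
  have hww : w₁ ≠ w₂ := by rintro rfl; exact ezz (ew₁.symm.trans ew₂)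
  -- colours on the common neighbours of `x` and `y` are distinct
  have inj : ∀ a b, G.Adj x a → G.Adj y a → G.Adj x b → G.Adj y b → f a = f b → a = b := by
    have h1 : ((nbr G x ∩ nbr G y).image f).card = (nbr G x ∩ nbr G y).card := by
      apply le_antisymm Finset.card_image_le
      have h2 : ({f x, f y} : Finset C)ᶜ ⊆ (nbr G x ∩ nbr G y).image f := by
        intro j hj
        simp only [Finset.mem_compl, Finset.mem_insert, Finset.mem_singleton, not_or] at hj
        obtain ⟨v, h1, h2, h3⟩ := h.exists_common s hj.1 hj.2
        simp only [Finset.mem_image, Finset.mem_inter, mem_nbr]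
        exact ⟨v, ⟨h1, h2⟩, h3⟩
      have h3 := Finset.card_le_card h2
      have h4 := Finset.card_add_card_compl ({f x, f y} : Finset C)
      have h5 := Finset.card_le_two (a := f x) (b := f y)
      have h6 := card_non_add hy
      have h7 : ({z₁, z₂} : Finset V) ⊆ non G x y := by
        intro u
        simp only [mem_insert, mem_singleton, mem_non]
        rintro (rfl | rfl) <;> simp_all
      have h8 := Finset.card_le_card h7
      rw [Finset.card_pair hzz.ne] at h8
      omega
    intro a b ha ha' hb hb' e
    exact Finset.card_image_iff.1 h1 (by simp [ha, ha']) (by simp [hb, hb']) e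
  have uniq : ∀ a, G.Adj x a → G.Adj y a → a ≠ w₁ → a ≠ w₂ → ∀ z, G.Adj x z → f z = f a → z = a := by
    intro a ha ha' h1 h2 z hz e
    by_cases hyz : G.Adj y z
    · exact inj z a hz hyz ha ha' e
    · have hne : y ≠ z := by
        rintro rfl
        exact s.proper ha' e
      rcases deg y z z₁ z₂ hy hz hz₁ hz₂ hne hyz₁ hyz₂ hyz nyz₁ nyz₂ with rfl | rfl | h3
      · exact absurd (inj a w₁ ha ha' hw₁ hyw₁ (e.symm.trans ew₁.symm)) h1
      · exact absurd (inj a w₂ ha ha' hw₂ hyw₂ (e.symm.trans ew₂.symm)) h2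
      · exact absurd h3 hzz.ne
  obtain ⟨T, hT, hT'⟩ := h.exists_card_singles s.symm
  -- The number of single colours is `2|C| - 3` minus a degree that is at most `2|C| - 6`.
  have hT3 : 3 ≤ T.card := by
    have := h.card_singles s.symm
    have := h.card_nbr_le y
    omega
  -- a vertex that is single for `y` misses only `w₁` and `w₂`
  have key : ∀ t ∈ T, ∀ u, G.Adj x u → t ≠ u → ¬ G.Adj t u →
      u = w₁ ∨ u = w₂ ∨ (u = z₁ ∧ t = w₁) ∨ (u = z₂ ∧ t = w₂) := by
    intro t ht u hu htu ntu
    obtain ⟨h1, h2, -, h3⟩ := hT' t ht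
    by_cases hyu : G.Adj y u
    · by_contra! hne
      refine ntu (h.adj_of_singles s hu (uniq u hu hyu hne.1 hne.2.1) h1 h3 hyu.ne' h2.ne' ?_).symm
      intro e
      exact htu (h3 u hyu e).symm
    · have hne : y ≠ u := by rintro rfl; exact ntu h1.symm
      rcases deg y u z₁ z₂ hy hu hz₁ hz₂ hne hyz₁ hyz₂ hyu nyz₁ nyz₂ with rfl | rfl | h4
      · have := deg u y w₁ t hu hy hw₁ h2 hne.symm hzw₁ htu.symm (fun e => nyz₁ e.symm) nzw₁
          (fun e => ntu e.symm)
        have := h1.ne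
        have := hyw₁.ne
        grind
      · have := deg u y w₂ t hu hy hw₂ h2 hne.symm hzw₂ htu.symm (fun e => nyz₂ e.symm) nzw₂
          (fun e => ntu e.symm)
        have := h1.ne
        have := hyw₂.ne
        grind
      · exact absurd h4 hzz.ne
  let I : Finset V := univ.filter fun u => G.Adj x u ∧ ∀ z, G.Adj x z → u ≠ z → G.Adj u z
  -- As `|C| ≤ 8`, at most one neighbour is adjacent to all the others.
  have hI : I.card + 7 ≤ Fintype.card C := by
    have := h.card_isolated_le x (I := I) (by intro u hu; simpa [I] using hu)
    omega
  have hI' : ∀ u, G.Adj x u → u ∉ I → ∃ z z', G.Adj x z ∧ G.Adj x z' ∧ z ≠ z' ∧ u ≠ z ∧ u ≠ z' ∧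
      ¬ G.Adj u z ∧ ¬ G.Adj u z' := by
    intro u hu huI
    simp only [I, mem_filter, mem_univ, true_and, not_and, not_forall] at huI
    obtain ⟨z, hz, huz, nuz⟩ := huI hu
    obtain ⟨z', hz', hzz', huz', nuz'⟩ := sec z u hz hu huz.symm (fun e => nuz e.symm)
    exact ⟨z, z', hz, hz', hzz'.ne, huz, huz', nuz, nuz'⟩
  have nsymm : ∀ a b, ¬ G.Adj a b → ¬ G.Adj b a := fun a b n e => n e.symm
  have hTw : ∀ t ∈ T, t ∉ I → t = w₁ ∨ t = w₂ ∨
      (t ≠ w₁ ∧ t ≠ w₂ ∧ ¬ G.Adj t w₁ ∧ ¬ G.Adj t w₂) := by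
    intro t ht htI
    obtain ⟨z, z', hz, hz', hzz', h1, h2, h3, h4⟩ := hI' t (hT' t ht).2.1 htI
    have h5 := key t ht z hz h1 h3
    have h6 := key t ht z' hz' h2 h4
    grind
  -- exactly one vertex of `T` is isolated and the others are `w₁` and `w₂`
  have hT2 : ∀ t ∈ T, t ∉ I → t = w₁ ∨ t = w₂ := by
    intro t ht htI
    by_contra! hne
    obtain ⟨-, -, n1, n2⟩ := (or_iff_right hne.2).1 ((or_iff_right hne.1).1 (hTw t ht htI))
    have h1 : 2 ≤ (T \ I).card := by
      have := Finset.le_card_sdiff I T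
      omega
    obtain ⟨t', ht', hne'⟩ := Finset.exists_mem_ne (by omega) t (s := T \ I)
    rw [mem_sdiff] at ht'
    have hxt := (hT' t ht).2.1
    have hxt' := (hT' t' ht'.1).2.1
    have hyt := (hT' t ht).1
    have hyt' := (hT' t' ht'.1).1
    -- Now `w₁` misses `z₁` and `t`, and `w₂` misses `z₂` and `t`. By `key`, the two vertices that
    -- `t'` misses produce a third non-neighbour of `w₁` or `w₂`.
    have d1 := deg w₁ z₁ t t' hw₁ hz₁ hxt hxt' hzw₁.symm hne.1.symm
    have d2 := deg w₂ z₂ t t' hw₂ hz₂ hxt hxt' hzw₂.symm hne.2.symm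
    have d3 := deg w₁ z₁ t w₂ hw₁ hz₁ hxt hw₂ hzw₁.symm hne.1.symm hww
    have d4 := deg w₂ z₂ t w₁ hw₂ hz₂ hxt hw₁ hzw₂.symm hne.2.symm hww.symm
    obtain ⟨u, u', hu, hu', huu', g1, g2, g3, g4⟩ := hI' t' hxt' ht'.2
    have k1 := key t' ht'.1 u hu g1 g3
    have k2 := key t' ht'.1 u' hu' g2 g4
    have := nsymm _ _ n1
    have := nsymm _ _ n2
    have := nsymm _ _ nzw₁
    have := nsymm _ _ nzw₂
    have := nsymm _ _ g3
    have := nsymm _ _ g4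
    have hz₁t : z₁ ≠ t := by rintro rfl; exact nyz₁ hyt
    have hz₁t' : z₁ ≠ t' := by rintro rfl; exact nyz₁ hyt'
    have hz₂t : z₂ ≠ t := by rintro rfl; exact nyz₂ hyt
    have hz₂t' : z₂ ≠ t' := by rintro rfl; exact nyz₂ hyt'
    have hz₁w₂ : z₁ ≠ w₂ := by rintro rfl; exact nyz₁ hyw₂
    have hz₂w₁ : z₂ ≠ w₁ := by rintro rfl; exact nyz₂ hyw₁
    grind
  have hTs : T ⊆ insert w₁ (insert w₂ I) := by
    intro t ht
    have := hT2 t ht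
    simp only [mem_insert]
    tauto
  have hwT : w₁ ∈ T ∧ w₂ ∈ T ∧ w₁ ∉ I ∧ w₂ ∉ I ∧ I.card = 1 := by
    have nw₁ : w₁ ∉ I := by
      intro hw
      simp only [I, mem_filter, mem_univ, true_and] at hw
      exact nzw₁ (hw.2 z₁ hz₁ hzw₁.symm).symm
    have nw₂ : w₂ ∉ I := by
      intro hw
      simp only [I, mem_filter, mem_univ, true_and] at hw
      exact nzw₂ (hw.2 z₂ hz₂ hzw₂.symm).symm
    have h1 : (insert w₁ (insert w₂ I)).card = I.card + 2 := by
      rw [Finset.card_insert_of_notMem (by simp [hww, nw₁]), Finset.card_insert_of_notMem nw₂]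
    have h2 := Finset.card_le_card hTs
    have h3 := Finset.eq_of_subset_of_card_le hTs (by omega)
    rw [h3]
    refine ⟨by simp, by simp, nw₁, nw₂, by omega⟩
  obtain ⟨hw₁T, hw₂T, hw₁I, hw₂I, hI1⟩ := hwT
  have hz₁w₂ : z₁ ≠ w₂ := by rintro rfl; exact nyz₁ hyw₂
  have hz₂w₁ : z₂ ≠ w₁ := by rintro rfl; exact nyz₂ hyw₁
  have nww : ¬ G.Adj w₁ w₂ := by
    obtain ⟨u, u', hu, hu', huu', g1, g2, g3, g4⟩ := hI' w₁ hw₁ hw₁I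
    have k1 := key w₁ hw₁T u hu g1 g3
    have k2 := key w₁ hw₁T u' hu' g2 g4
    grind
  -- the remaining three neighbours form an independent set
  let F : Finset V := {y, z₁, z₂, w₁, w₂}
  let R : Finset V := nbr G x \ (F ∪ I)
  have hR : 3 ≤ R.card := by
    have h1 : F.card ≤ 5 := Finset.card_le_five
    have h2 := Finset.le_card_sdiff (F ∪ I) (nbr G x)
    have h3 := Finset.card_union_le F I
    -- `|I| = 1` and `|I| + 7 ≤ |C|` force `|C| = 8`.
    have : 9 ≤ (nbr G x).card := by omega
    simp only [R]
    omega
  have hR' : ∀ r, r ∈ R ↔ G.Adj x r ∧ r ≠ y ∧ r ≠ z₁ ∧ r ≠ z₂ ∧ r ≠ w₁ ∧ r ≠ w₂ ∧ r ∉ I := by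
    intro r
    simp only [R, F, mem_sdiff, mem_nbr, mem_union, mem_insert, mem_singleton, not_or]
    tauto
  have hRc : R.card = 3 := by
    have h1 : F ∪ I ⊆ nbr G x := by
      intro u hu
      simp only [F, I, mem_union, mem_insert, mem_singleton, mem_filter, mem_univ, true_and] at hu
      rw [mem_nbr]
      rcases hu with (rfl | rfl | rfl | rfl | rfl) | hu
      all_goals first | assumption | exact hu.1
    have h2 : F.card = 5 := by
      have := hyw₁.ne
      have := hyw₂.ne
      have := hzz.ne
      simp only [F]
      repeat rw [Finset.card_insert_of_notMem (by simp; grind)]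
      simp
    have h3 : Disjoint F I := by
      rw [Finset.disjoint_left]
      intro u hu huI
      simp only [I, mem_filter, mem_univ, true_and] at huI
      simp only [F, mem_insert, mem_singleton] at hu
      rcases hu with rfl | rfl | rfl | rfl | rfl
      · exact nyz₁ (huI.2 z₁ hz₁ hyz₁)
      · exact nzw₁ (huI.2 w₁ hw₁ hzw₁)
      · exact nzw₂ (huI.2 w₂ hw₂ hzw₂)
      · exact nww (huI.2 w₂ hw₂ hww)
      · exact nww (huI.2 w₁ hw₁ hww.symm).symm
    have h4 := Finset.card_union_of_disjoint h3
    simp only [R]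
    rw [Finset.card_sdiff_of_subset h1]
    omega
  have hRn : ∀ r ∈ R, ∀ u, G.Adj x u → r ≠ u → ¬ G.Adj r u → u ∈ R := by
    intro r hr u hu hru nru
    rw [hR'] at hr ⊢
    have nur := nsymm _ _ nru
    have := nsymm _ _ nyz₁
    have := nsymm _ _ nyz₂
    have := nsymm _ _ nzw₁
    have := nsymm _ _ nzw₂
    have := nsymm _ _ nww
    have := hyw₁.ne
    have := hyw₂.ne
    have := hzz.ne
    refine ⟨hu, ?_, ?_, ?_, ?_, ?_, ?_⟩
    · rintro rfl; have := deg u z₁ z₂ r; grind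
    · rintro rfl; have := deg u y w₁ r; grind
    · rintro rfl; have := deg u y w₂ r; grind
    · rintro rfl; have := deg u z₁ w₂ r; grind
    · rintro rfl; have := deg u z₂ w₁ r; grind
    · intro huI
      simp only [I, mem_filter, mem_univ, true_and] at huI
      exact nur (huI.2 r hr.1 hru.symm)
  -- Each vertex of `R` misses two others, both in `R`; an edge inside `R` would require a fourth
  -- element.
  have hle := h.card_indep_le (x := x) (s := R) (fun z hz => ((hR' z).1 hz).1) (by
    intro a ha b hb hab
    obtain ⟨u, u', hu, hu', huu', g1, g2, g3, g4⟩ :=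
      hI' a ((hR' a).1 ha).1 ((hR' a).1 ha).2.2.2.2.2.2
    have m1 := hRn a ha u hu g1 g3
    have m2 := hRn a ha u' hu' g2 g4
    have h4 : ({a, b, u, u'} : Finset V) ⊆ R := by
      intro v
      simp only [mem_insert, mem_singleton]
      rintro (rfl | rfl | rfl | rfl) <;> assumption
    have h5 := Finset.card_le_card h4
    have : b ≠ u := by rintro rfl; exact g3 hab
    have : b ≠ u' := by rintro rfl; exact g4 hab
    have := hab.ne
    have h6 : ({a, b, u, u'} : Finset V).card = 4 := by
      repeat rw [Finset.card_insert_of_notMem (by simp; grind)]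
      simp
    omega)
  omega

end DoubleCritical

/-! ### Eight colours, degree ten: flexible cliques. -/

namespace DoubleCritical

set_option linter.unusedSectionVars false

open Finset
open scoped Classical

variable {V C : Type*} {G : SimpleGraph V} {f : V → C} {x y : V} [Fintype V] [Fintype C]

theorem Crit.card_eq_eight (h : Crit G C) (hC : Fintype.card C ≤ 8) (x : V) :
    Fintype.card C = 8 := by
  have := h.lt_card_nbr x
  have := h.card_nbr_le x
  have := h.card_nbr_ne hC x
  omega

theorem Crit.card_nbr_eq_ten (h : Crit G C) (hC : Fintype.card C = 8) (x : V) :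
    (nbr G x).card = 10 := by
  have := h.lt_card_nbr x
  have := h.card_nbr_le x
  have := h.card_nbr_ne hC.le x
  omega

theorem Crit.card_non_le_three (h : Crit G C) (hC : Fintype.card C = 8) (hxy : G.Adj x y) :
    (non G x y).card ≤ 3 := by
  have := h.card_nbr_eq_ten hC x
  have := h.card_non_le hxy
  omega

/-- The complement of the neighbourhood of `x` has a perfect matching. -/
theorem Crit.exists_matching (h : Crit G C) (hC : Fintype.card C = 8) (x : V) :
    ∃ p : V → V, (∀ u, G.Adj x u → G.Adj x (p u) ∧ u ≠ p u ∧ ¬ G.Adj u (p u)) ∧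
      ∀ u v, G.Adj x u → G.Adj x v → p u = p v → u = v := by
  obtain ⟨g, D, hg, hD, hz⟩ := h.exists_nbr_coloring x
  have h1 : (nbr G x).card = ∑ j ∈ D, (cnbr G g x j).card := by
    rw [Finset.card_eq_sum_card_fiberwise (f := g) (t := D) (by simpa [Set.MapsTo] using hz)]
    refine Finset.sum_congr rfl fun j _ => ?_
    congr 1
    ext z
    simp
  -- Ten neighbours in five colours, at most two of each: all bounds are equalities.
  have h2 : ∀ j ∈ D, (cnbr G g x j).card = 2 := by
    rw [← Finset.sum_eq_sum_iff_of_le fun j _ => h.card_cnbr_le hg x j, ← h1,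
      h.card_nbr_eq_ten hC, Finset.sum_const, smul_eq_mul]
    omega
  have h3 : ∀ u, G.Adj x u → ∃ v, cnbr G g x (g u) = {u, v} ∧ u ≠ v := by
    intro u hu
    obtain ⟨a, b, hab, he⟩ := Finset.card_eq_two.1 (h2 _ (hz u hu))
    have : u ∈ cnbr G g x (g u) := by simp [hu]
    rw [he] at this ⊢
    simp only [mem_insert, mem_singleton] at this
    rcases this with rfl | rfl
    · exact ⟨b, rfl, hab⟩
    · exact ⟨a, Finset.pair_comm _ _, hab.symm⟩
  have : Nonempty V := ⟨x⟩
  choose! p hp using h3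
  have h4 : ∀ u, G.Adj x u → G.Adj x (p u) ∧ g (p u) = g u := by
    intro u hu
    have : p u ∈ cnbr G g x (g u) := by simp [(hp u hu).1]
    simpa using this
  refine ⟨p, fun u hu => ⟨(h4 u hu).1, (hp u hu).2, fun e => hg e (h4 u hu).2.symm⟩, fun u v hu hv e => ?_⟩
  have h5 : g u = g v := by rw [← (h4 u hu).2, e, (h4 v hv).2]
  have h6 : v ∈ cnbr G g x (g u) := by simp [hv, h5]
  rw [(hp u hu).1, mem_insert, mem_singleton, e] at h6
  rcases h6 with h6 | h6
  · exact h6.symm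
  · exact absurd h6 (hp v hv).2

/-- A clique `K` in which the singleton colour classes can be placed at any two vertices, without
changing the classes of the colours in `L`. -/
structure Flex (G : SimpleGraph V) (g : V → C) (K : Finset V) (L : Finset C) : Prop where
  card : K.card + L.card = Fintype.card C
  two_le : 2 ≤ K.card
  notMem : ∀ z ∈ K, g z ∉ L
  state : ∀ u ∈ K, ∀ v ∈ K, u ≠ v → ∃ f : V → C, State G f u v ∧ ∀ z, ∀ l ∈ L, f z = l ↔ g z = l

namespace Flex

variable {g : V → C} {K : Finset V} {L : Finset C} {u v : V} {l l' : C}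

theorem exists_ne (F : Flex G g K L) (u : V) : ∃ v ∈ K, v ≠ u := by
  have := F.two_le
  exact Finset.exists_mem_ne (by omega) u

theorem adj (F : Flex G g K L) (h : Crit G C) (hu : u ∈ K) (hv : v ∈ K) (huv : u ≠ v) :
    G.Adj u v := by
  obtain ⟨f, s, -⟩ := F.state u hu v hv huv
  exact h.adj s

theorem ne_of_mem (F : Flex G g K L) (hu : u ∈ K) {z : V} (hz : g z ∈ L) : z ≠ u := by
  rintro rfl
  exact F.notMem z hu hz

theorem state' (F : Flex G g K L) (hu : u ∈ K) (hv : v ∈ K) (huv : u ≠ v) :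
    ∃ f : V → C, State G f u v ∧ (∀ z, ∀ l ∈ L, f z = l ↔ g z = l) ∧
      (∀ l ∈ L, l ≠ f u ∧ l ≠ f v) ∧ ∀ w, ∀ l ∈ L, cnbr G f w l = cnbr G g w l := by
  obtain ⟨f, s, hf⟩ := F.state u hu v hv huv
  refine ⟨f, s, hf, fun l hl => ⟨fun e => ?_, fun e => ?_⟩, fun w l hl => ?_⟩
  · have := (hf u l hl).1 e.symm
    exact F.notMem u hu (this ▸ hl)
  · have := (hf v l hl).1 e.symm
    exact F.notMem v hv (this ▸ hl)
  · ext z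
    simp [hf z l hl]

theorem card_cnbr_le (F : Flex G g K L) (h : Crit G C) (hl : l ∈ L) (z : V) :
    (cnbr G g z l).card ≤ 2 := by
  obtain ⟨u, hu, -⟩ := F.exists_ne z
  obtain ⟨v, hv, hvu⟩ := F.exists_ne u
  obtain ⟨f, s, hf, -, hc⟩ := F.state' hu hv hvu.symm
  rw [← hc z l hl]
  exact h.card_cnbr_le s.proper z l

theorem exists_common (F : Flex G g K L) (h : Crit G C) (hu : u ∈ K) (hv : v ∈ K) (huv : u ≠ v)
    (hl : l ∈ L) : ∃ c, G.Adj u c ∧ G.Adj v c ∧ g c = l := by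
  obtain ⟨f, s, hf, hn, -⟩ := F.state' hu hv huv
  obtain ⟨c, h1, h2, h3⟩ := h.exists_common s (hn l hl).1 (hn l hl).2
  exact ⟨c, h1, h2, (hf c l hl).1 h3⟩

theorem card_cnbr_pos (F : Flex G g K L) (h : Crit G C) (hu : u ∈ K) (hl : l ∈ L) :
    1 ≤ (cnbr G g u l).card := by
  obtain ⟨v, hv, hvu⟩ := F.exists_ne u
  obtain ⟨c, h1, -, h3⟩ := F.exists_common h hu hv hvu.symm hl
  exact Finset.card_pos.2 ⟨c, by simp [h1, h3]⟩

/-- The common neighbour of `u` and `v` in colour `l` can only be `c`. -/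
theorem adj_single (F : Flex G g K L) (h : Crit G C) (hu : u ∈ K) (hv : v ∈ K) (hl : l ∈ L)
    {c : V} (hc : cnbr G g u l = {c}) : G.Adj v c := by
  by_cases huv : u = v
  · subst huv
    have : c ∈ cnbr G g u l := by simp [hc]
    exact (mem_cnbr.1 this).1
  · obtain ⟨c', h1, h2, h3⟩ := F.exists_common h hu hv huv hl
    have : c' ∈ cnbr G g u l := by simp [h1, h3]
    rw [hc, mem_singleton] at this
    exact this ▸ h2

theorem single_adj_single (F : Flex G g K L) (h : Crit G C) (hu : u ∈ K) (hv : v ∈ K)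
    (huv : u ≠ v) (hl : l ∈ L) (hl' : l' ∈ L) (hll : l ≠ l') {c c' : V}
    (hc : cnbr G g u l = {c}) (hc' : cnbr G g v l' = {c'}) : G.Adj c c' := by
  obtain ⟨f, s, hf, hn, -⟩ := F.state' hu hv huv
  obtain ⟨a, b, h1, h2, h3, h4, h5⟩ := h.exists_path s (hn l hl).1 (hn l hl).2 (hn l' hl').1
    (hn l' hl').2 hll
  have ha : a ∈ cnbr G g u l := by simp [h1, (hf a l hl).1 h4]
  have hb : b ∈ cnbr G g v l' := by simp [h3, (hf b l' hl').1 h5]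
  rw [hc, mem_singleton] at ha
  rw [hc', mem_singleton] at hb
  exact ha ▸ hb ▸ h2

theorem color_of_single {c : V} (hc : cnbr G g u l = {c}) : g c = l := by
  have : c ∈ cnbr G g u l := by simp [hc]
  exact (mem_cnbr.1 this).2

/-- A colour that is single for two vertices of `K` yields a larger clique. -/
theorem extend (F : Flex G g K L) (h : Crit G C) (hu : u ∈ K) (hv : v ∈ K) (huv : u ≠ v)
    (hl : l ∈ L) (hcu : (cnbr G g u l).card = 1) (hcv : (cnbr G g v l).card = 1) :
    ∃ c, c ∉ K ∧ Flex G g (insert c K) (L.erase l) := by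
  obtain ⟨c, hc⟩ := Finset.card_eq_one.1 hcu
  obtain ⟨c', hc'⟩ := Finset.card_eq_one.1 hcv
  have hcc : c' = c := by
    have : c ∈ cnbr G g v l := by
      simp [F.adj_single h hu hv hl hc, color_of_single hc]
    rw [hc', mem_singleton] at this
    exact this.symm
  subst hcc
  have hgc := color_of_single hc
  have hcK : c' ∉ K := fun hk => F.notMem c' hk (hgc ▸ hl)
  have key : ∀ w ∈ K, ∃ f : V → C, State G f c' w ∧ ∀ z, ∀ k ∈ L.erase l, f z = k ↔ g z = k := by
    intro w hw
    -- Two vertices with the same single colour are needed here: one of them differs from `w`, and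
    -- its singleton moves to `c'` while `w` keeps its own.
    obtain ⟨o, ho, how, hco⟩ : ∃ o ∈ K, o ≠ w ∧ cnbr G g o l = {c'} := by
      by_cases hwu : u = w
      · exact ⟨v, hv, fun e => huv (hwu.trans e.symm), hc'⟩
      · exact ⟨u, hu, hwu, hc⟩
    obtain ⟨f, s, hf, hn, hcn⟩ := F.state' ho hw how
    have hfc : f c' = l := (hf c' l hl).2 hgc
    refine ⟨f ∘ Equiv.swap o c', s.move ?_ ?_ ?_, ?_⟩
    · rw [hfc]; exact (hn l hl).2
    · exact F.ne_of_mem ho (hgc ▸ hl)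
    · intro z hz e
      have : z ∈ cnbr G f o l := by simp [hz, e, hfc]
      rw [hcn o l hl, hco, mem_singleton] at this
      exact this
    · intro z k hk
      rw [mem_erase] at hk
      rw [move_apply]
      have h1 := hf z k hk.2
      have h2 := F.notMem o ho
      have h3 := (hn k hk.2).1
      by_cases hzo : z = o
      · subst hzo
        rw [if_pos rfl, hfc]
        refine ⟨fun e => absurd e.symm hk.1, fun e => absurd (e ▸ hk.2) h2⟩
      · rw [if_neg hzo]
        by_cases hzc : z = c'
        · subst hzc
          rw [if_pos rfl, hgc]
          exact ⟨fun e => absurd e.symm h3, fun e => absurd e.symm hk.1⟩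
        · rw [if_neg hzc]
          exact h1
  refine ⟨c', hcK, ?_, ?_, ?_, ?_⟩
  · rw [Finset.card_insert_of_notMem hcK, ← F.card, ← Finset.card_erase_add_one hl]
    omega
  · rw [Finset.card_insert_of_notMem hcK]
    have := F.two_le
    omega
  · intro z hz
    rw [mem_insert] at hz
    rw [mem_erase, not_and_or]
    rcases hz with rfl | hz
    · left; simpa using hgc
    · right; exact F.notMem z hz
  · intro a ha b hb hab
    rw [mem_insert] at ha hb
    rcases ha with rfl | ha <;> rcases hb with rfl | hb
    · exact absurd rfl hab
    · exact key b hb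
    · obtain ⟨f, s, hf⟩ := key a ha
      exact ⟨f, s.symm, hf⟩
    · obtain ⟨f, s, hf⟩ := F.state a ha b hb hab
      exact ⟨f, s, fun z k hk => hf z k (Finset.mem_of_mem_erase hk)⟩

theorem union_subset (F : Flex G g K L) (h : Crit G C) (hu : u ∈ K) :
    K.erase u ∪ L.biUnion (fun l => cnbr G g u l) ⊆ nbr G u := by
  intro z
  simp only [mem_union, mem_erase, mem_biUnion, mem_cnbr, mem_nbr]
  rintro (⟨h1, h2⟩ | ⟨l, -, h1, -⟩)
  · exact F.adj h hu h2 h1.symm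
  · exact h1

theorem card_union (F : Flex G g K L) (u : V) :
    (K.erase u ∪ L.biUnion (fun l => cnbr G g u l)).card =
      (K.erase u).card + ∑ l ∈ L, (cnbr G g u l).card := by
  rw [Finset.card_union_of_disjoint, Finset.card_biUnion]
  · intro i _ j _ hij
    rw [Function.onFun, Finset.disjoint_left]
    intro z
    simp only [mem_cnbr]
    rintro ⟨-, rfl⟩ ⟨-, h⟩
    exact hij h
  · rw [Finset.disjoint_left]
    intro z hz
    simp only [mem_biUnion, mem_cnbr, not_exists, not_and]
    rintro l hl - rfl
    exact F.notMem z (Finset.mem_of_mem_erase hz) hl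

/-- A vertex of `K` has at least `5 - |K|` single colours in `L`. -/
theorem le_card_singles (F : Flex G g K L) (h : Crit G C) (hC : Fintype.card C = 8)
    (hu : u ∈ K) : 5 ≤ K.card + (L.filter fun l => (cnbr G g u l).card = 1).card := by
  have h1 := Finset.card_le_card (F.union_subset h hu)
  rw [F.card_union, h.card_nbr_eq_ten hC] at h1
  have h2 := Finset.card_erase_add_one hu
  have h3 : 2 * L.card ≤ ∑ l ∈ L, (cnbr G g u l).card +
      (L.filter fun l => (cnbr G g u l).card = 1).card := by
    rw [Finset.card_filter, ← Finset.sum_add_distrib, mul_comm, ← smul_eq_mul]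
    refine Finset.card_nsmul_le_sum _ _ _ fun l hl => ?_
    have := F.card_cnbr_pos h hu hl
    split_ifs <;> omega
  have h4 := F.card
  omega

/-- The number of neighbours of `z` in `K`. -/
noncomputable def kap (G : SimpleGraph V) (K : Finset V) (z : V) : ℕ :=
  (K.filter fun v => G.Adj z v).card

/-- The vertices of colour `l` with a neighbour in `K`. -/
noncomputable def touched (G : SimpleGraph V) (g : V → C) (K : Finset V) (l : C) : Finset V :=
  K.biUnion fun v => cnbr G g v l

theorem mem_touched {z : V} : z ∈ touched G g K l ↔ ∃ v ∈ K, G.Adj v z ∧ g z = l := by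
  simp [touched]

theorem sum_kap (g : V → C) (K : Finset V) (l : C) :
    ∑ z ∈ touched G g K l, kap G K z = ∑ v ∈ K, (cnbr G g v l).card := by
  have := Finset.sum_card_bipartiteAbove_eq_sum_card_bipartiteBelow (s := touched G g K l) (t := K)
    (fun z v => G.Adj z v)
  unfold kap
  refine this.trans (Finset.sum_congr rfl fun v hv => ?_)
  congr 1
  ext z
  simp only [Finset.mem_bipartiteBelow, mem_touched, mem_cnbr]
  constructor
  · rintro ⟨⟨w, -, -, h⟩, h'⟩
    exact ⟨h'.symm, h⟩
  · rintro ⟨h, h'⟩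
    exact ⟨⟨v, hv, h, h'⟩, h.symm⟩

theorem subset_non (F : Flex G g K L) (h : Crit G C) (hu : u ∈ K) (hl : l ∈ L) {z z' : V}
    (hz : z ∈ cnbr G g u l) (hz' : z' ∈ cnbr G g u l) (hzz : z ≠ z') :
    insert z' (K.filter fun v => ¬ G.Adj z v) ⊆ non G u z := by
  obtain ⟨h1, h2⟩ := mem_cnbr.1 hz
  obtain ⟨h3, h4⟩ := mem_cnbr.1 hz'
  intro w
  simp only [mem_insert, mem_filter, mem_non]
  rintro (rfl | ⟨hw, hwz⟩)
  · refine ⟨h3, hzz, fun e => ?_⟩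
    obtain ⟨v, hv, hvu⟩ := F.exists_ne u
    obtain ⟨f, s, hf, -⟩ := F.state' hu hv hvu.symm
    exact s.proper e (((hf z l hl).2 h2).trans ((hf w l hl).2 h4).symm)
  · refine ⟨F.adj h hu hw ?_, F.ne_of_mem hw (h2 ▸ hl), hwz⟩
    rintro rfl
    exact hwz h1.symm

theorem card_insert (F : Flex G g K L) (hl : l ∈ L) {z z' : V} (hz' : g z' = l) :
    (insert z' (K.filter fun v => ¬ G.Adj z v)).card + kap G K z = K.card + 1 := by
  rw [Finset.card_insert_of_notMem, kap]
  · have := Finset.card_filter_add_card_filter_not (s := K) (fun v => G.Adj z v)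
    omega
  · intro hm
    exact F.notMem z' (Finset.mem_filter.1 hm).1 (hz' ▸ hl)

/-- Among the neighbours of `u`, `z` misses the other vertex of its colour and all its
non-neighbours in `K`, but at most three in total. -/
theorem le_kap (F : Flex G g K L) (h : Crit G C) (hC : Fintype.card C = 8) (hu : u ∈ K)
    (hl : l ∈ L) {z : V} (hz : z ∈ cnbr G g u l) (h2 : (cnbr G g u l).card = 2) :
    K.card ≤ kap G K z + 2 := by
  obtain ⟨z', hz', hne⟩ := Finset.exists_mem_ne (by omega : 1 < (cnbr G g u l).card) z
  have h1 := Finset.card_le_card (F.subset_non h hu hl hz hz' hne.symm)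
  have h3 := h.card_non_le_three hC (mem_cnbr.1 hz).1
  have h4 := F.card_insert hl (z := z) (mem_cnbr.1 hz').2
  omega

/-- Equality in `le_kap` accounts for all three vertices that `z` misses near `u`, so `z` is
adjacent to both neighbours of `u` of colour `l'`, and it has no more than two of that colour. -/
theorem cnbr_eq_of_kap (F : Flex G g K L) (h : Crit G C) (hC : Fintype.card C = 8) (hu : u ∈ K)
    (hl : l ∈ L) (hl' : l' ∈ L) (hll : l' ≠ l) {z : V} (hz : z ∈ cnbr G g u l)
    (h2 : (cnbr G g u l).card = 2) (h2' : (cnbr G g u l').card = 2)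
    (hk : kap G K z + 2 = K.card) : cnbr G g u l' = cnbr G g z l' := by
  apply Finset.eq_of_subset_of_card_le
  · obtain ⟨z', hz', hne⟩ := Finset.exists_mem_ne (by omega : 1 < (cnbr G g u l).card) z
    have h1 := F.subset_non h hu hl hz hz' hne.symm
    have h3 := h.card_non_le_three hC (mem_cnbr.1 hz).1
    have h4 := F.card_insert hl (z := z) (mem_cnbr.1 hz').2
    have h5 := Finset.eq_of_subset_of_card_le h1 (by omega)
    intro w hw
    rw [mem_cnbr] at hw ⊢
    refine ⟨?_, hw.2⟩
    by_contra hzw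
    have hwz : z ≠ w := by
      rintro rfl
      exact hll (hw.2.symm.trans (mem_cnbr.1 hz).2)
    have h6 : w ∈ non G u z := by simp [hw.1, hwz, hzw]
    rw [← h5, mem_insert, mem_filter] at h6
    rcases h6 with rfl | ⟨h6, -⟩
    · exact hll (hw.2.symm.trans (mem_cnbr.1 hz').2)
    · exact F.notMem w h6 (hw.2 ▸ hl')
  · rw [h2']
    exact F.card_cnbr_le h hl' z

/-- If two vertices of colour `l` have only `|K| - 2` neighbours in `K`, then every vertex of
another colour touching `K` is complete to `K`. -/
theorem kap_eq (F : Flex G g K L) (h : Crit G C) (hC : Fintype.card C = 8) (hK : 5 ≤ K.card)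
    (hl : l ∈ L) (hl' : l' ∈ L) (hll : l' ≠ l) (h2 : ∀ v ∈ K, (cnbr G g v l).card = 2)
    (h2' : ∀ v ∈ K, (cnbr G g v l').card = 2) (hT : (touched G g K l).card ≤ 3) {a b : V}
    (ha : a ∈ touched G g K l) (hb : b ∈ touched G g K l) (hab : a ≠ b)
    (hka : kap G K a + 2 = K.card) (hkb : kap G K b + 2 = K.card) :
    ∀ z ∈ touched G g K l', kap G K z = K.card := by
  have hga : g a = l := by obtain ⟨-, -, -, h⟩ := mem_touched.1 ha; exact h
  have hgb : g b = l := by obtain ⟨-, -, -, h⟩ := mem_touched.1 hb; exact h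
  have hA : ∀ v ∈ K, G.Adj a v → cnbr G g v l' = cnbr G g a l' := fun v hv hav =>
    F.cnbr_eq_of_kap h hC hv hl hl' hll (by simp [hav.symm, hga]) (h2 v hv) (h2' v hv) hka
  have hB : ∀ v ∈ K, G.Adj b v → cnbr G g v l' = cnbr G g b l' := fun v hv hbv =>
    F.cnbr_eq_of_kap h hC hv hl hl' hll (by simp [hbv.symm, hgb]) (h2 v hv) (h2' v hv) hkb
  have hAB : cnbr G g a l' = cnbr G g b l' := by
    -- Two subsets of `K` of size `|K| - 2` meet, because `|K| ≥ 5`.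
    obtain ⟨v, hv⟩ : ((K.filter fun v => G.Adj a v) ∩ (K.filter fun v => G.Adj b v)).Nonempty := by
      rw [← Finset.card_pos]
      have h1 := Finset.card_union_add_card_inter (K.filter fun v => G.Adj a v)
        (K.filter fun v => G.Adj b v)
      have h3 : ((K.filter fun v => G.Adj a v) ∪ (K.filter fun v => G.Adj b v)).card ≤ K.card :=
        Finset.card_le_card (Finset.union_subset (Finset.filter_subset _ _)
          (Finset.filter_subset _ _))
      unfold kap at hka hkb
      omega
    simp only [mem_inter, mem_filter] at hv
    rw [← hA v hv.1.1 hv.1.2, hB v hv.1.1 hv.2.2]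
  have hall : ∀ v ∈ K, cnbr G g v l' = cnbr G g a l' := by
    intro v hv
    by_cases hav : G.Adj a v
    · exact hA v hv hav
    by_cases hbv : G.Adj b v
    · rw [hB v hv hbv, hAB]
    -- A vertex `v` missing both `a` and `b` would have at most one candidate left for its two
    -- neighbours of colour `l`.
    exfalso
    have h1 : cnbr G g v l ⊆ ((touched G g K l).erase a).erase b := by
      intro w hw
      have hw' := mem_cnbr.1 hw
      simp only [mem_erase]
      refine ⟨?_, ?_, mem_touched.2 ⟨v, hv, hw'⟩⟩
      · rintro rfl; exact hbv hw'.1.symm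
      · rintro rfl; exact hav hw'.1.symm
    have h3 := Finset.card_le_card h1
    rw [h2 v hv, Finset.card_erase_of_mem (by simp [hab.symm, hb]),
      Finset.card_erase_of_mem ha] at h3
    omega
  intro z hz
  obtain ⟨v, hv, hvz, hgz⟩ := mem_touched.1 hz
  unfold kap
  rw [Finset.filter_true_of_mem]
  intro w hw
  have : z ∈ cnbr G g w l' := by
    rw [hall w hw, ← hall v hv]
    simp [hvz, hgz]
  exact (mem_cnbr.1 this).1.symm

/-- `K` does not extend to a clique with seven vertices. -/
theorem not_complete (F : Flex G g K L) (h : Crit G C) (hC : Fintype.card C = 8)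
    {S : Finset V} (hS : 7 ≤ K.card + S.card) (hSK : ∀ s ∈ S, ∀ v ∈ K, G.Adj v s)
    (hSS : ∀ s ∈ S, ∀ t ∈ S, s ≠ t → G.Adj s t) : False := by
  have hd : Disjoint K S := by
    rw [Finset.disjoint_left]
    intro z hz hz'
    exact (hSK z hz' z hz).ne rfl
  have := F.two_le
  obtain ⟨v, hv⟩ := Finset.card_pos.1 (by omega : 0 < K.card)
  have := h.card_clique_le (K := K ∪ S) (by
    intro a ha b hb hab
    rw [mem_union] at ha hb
    rcases ha with ha | ha <;> rcases hb with hb | hb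
    · exact F.adj h ha hb hab
    · exact hSK b hb a ha
    · exact (hSK a ha b hb).symm
    · exact hSS a ha b hb hab) ⟨v, by simp [hv]⟩
  rw [Finset.card_union_of_disjoint hd] at this
  omega

theorem kap_lt (F : Flex G g K L) (h : Crit G C) (hC : Fintype.card C = 8) (hK : K.card = 6)
    (z : V) : kap G K z < K.card := by
  refine lt_of_le_of_ne (Finset.card_filter_le _ _) fun e => ?_
  have h1 : K.filter (fun v => G.Adj z v) = K :=
    Finset.eq_of_subset_of_card_le (Finset.filter_subset _ _) e.ge
  refine F.not_complete h hC (S := {z}) (by simp [hK]) ?_ (by simp)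
  simp only [mem_singleton, forall_eq]
  intro v hv
  rw [← h1] at hv
  exact (Finset.mem_filter.1 hv).2.symm

end Flex

end DoubleCritical

/-! ### No flexible clique has three to six vertices. -/

namespace DoubleCritical

set_option linter.unusedSectionVars false

open Finset
open scoped Classical

variable {V C : Type*} {G : SimpleGraph V} {f : V → C} {x y : V} [Fintype V] [Fintype C]

namespace Flex

variable {g : V → C} {K : Finset V} {L : Finset C} {u v : V} {l l' : C}

theorem card_cnbr_eq (F : Flex G g K L) (h : Crit G C) (hu : u ∈ K) (hl : l ∈ L) :
    (cnbr G g u l).card = 1 ∨ (cnbr G g u l).card = 2 := by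
  have := F.card_cnbr_pos h hu hl
  have := F.card_cnbr_le h hl u
  omega

theorem mem_touched_of_mem (hu : u ∈ K) {z : V} (hz : z ∈ cnbr G g u l) :
    z ∈ touched G g K l :=
  mem_touched.2 ⟨u, hu, mem_cnbr.1 hz⟩

/-- A single colour would extend `K` to a seven-clique, so each vertex of `K` sees each of the two
colours in `L` twice. The twelve incidences of one colour come from vertices with four or five
neighbours in `K`, hence from three with four each; `kap_eq` then makes a vertex of the other colour
complete to `K`. -/
theorem card_ne_six (F : Flex G g K L) (h : Crit G C) (hC : Fintype.card C = 8) :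
    K.card ≠ 6 := by
  intro hK
  have h2 : ∀ l ∈ L, ∀ u ∈ K, (cnbr G g u l).card = 2 := by
    intro l hl u hu
    refine (F.card_cnbr_eq h hu hl).resolve_left fun e => ?_
    obtain ⟨c, hc⟩ := Finset.card_eq_one.1 e
    refine F.not_complete h hC (S := {c}) (by simp [hK]) ?_ (by simp)
    simp only [mem_singleton, forall_eq]
    exact fun v hv => F.adj_single h hu hv hl hc
  have hL : 1 < L.card := by have := F.card; omega
  obtain ⟨l, l', hl, hl', hll⟩ := Finset.one_lt_card_iff.1 hL
  have hk : ∀ z ∈ touched G g K l, 4 ≤ kap G K z ∧ kap G K z ≤ 5 := by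
    intro z hz
    obtain ⟨v, hv, hz⟩ := mem_touched.1 hz
    have := F.le_kap h hC hv hl (z := z) (by simpa using hz) (h2 l hl v hv)
    have := F.kap_lt h hC hK z
    omega
  have hs : ∑ z ∈ touched G g K l, kap G K z = 12 := by
    rw [sum_kap, Finset.sum_congr rfl fun v hv => h2 l hl v hv]
    simp [hK]
  have h3 : (touched G g K l).card • 4 ≤ 12 :=
    hs ▸ Finset.card_nsmul_le_sum _ _ _ fun z hz => (hk z hz).1
  have h4 : 12 ≤ (touched G g K l).card • 5 :=
    hs ▸ Finset.sum_le_card_nsmul _ _ _ fun z hz => (hk z hz).2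
  simp only [smul_eq_mul] at h3 h4
  have h5 : ∀ z ∈ touched G g K l, kap G K z = 4 := by
    have h6 : ∑ z ∈ touched G g K l, 4 = ∑ z ∈ touched G g K l, kap G K z := by
      rw [hs, Finset.sum_const, smul_eq_mul]
      omega
    exact fun z hz => ((Finset.sum_eq_sum_iff_of_le fun z hz => (hk z hz).1).1 h6 z hz).symm
  obtain ⟨a, b, ha, hb, hab⟩ := Finset.one_lt_card_iff.1 (by omega : 1 < (touched G g K l).card)
  obtain ⟨v, hv⟩ := Finset.card_pos.1 (by omega : 0 < K.card)
  obtain ⟨z, hz⟩ := Finset.card_pos.1 (F.card_cnbr_pos h hv hl')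
  have h6 := F.kap_eq h hC (by omega) hl hl' hll.symm (h2 l hl) (h2 l' hl') (by omega) ha hb hab
    (by rw [h5 a ha, hK]) (by rw [h5 b hb, hK]) z (mem_touched_of_mem hv hz)
  exact (F.kap_lt h hC hK z).ne h6

/-- For a flexible clique with five vertices, a colour either is unique in the neighbourhoods of
at most one vertex and induces the same neighbours on the other ones, or has two vertices with
exactly three neighbours in the clique. -/
theorem const_or_exists (F : Flex G g K L) (h : Crit G C) (hC : Fintype.card C = 8)
    (hK : K.card = 5) {v₀ : V} (hv₀ : ∀ u ∈ K, u ≠ v₀ → ∀ l ∈ L, (cnbr G g u l).card = 2)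
    (hl : l ∈ L) :
    (∀ u ∈ K, ∀ v ∈ K, u ≠ v₀ → v ≠ v₀ → cnbr G g u l = cnbr G g v l) ∨
    ((∀ v ∈ K, (cnbr G g v l).card = 2) ∧ (touched G g K l).card ≤ 3 ∧
      ∃ a ∈ touched G g K l, ∃ b ∈ touched G g K l, a ≠ b ∧ kap G K a = 3 ∧ kap G K b = 3) := by
  have hkle : ∀ z, kap G K z ≤ 5 := fun z => hK ▸ Finset.card_filter_le _ _
  have hsing : ∀ v ∈ K, ∀ c, cnbr G g v l = {c} → kap G K c = 5 := by
    intro v hv c hc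
    rw [kap, Finset.filter_true_of_mem, hK]
    exact fun w hw => (F.adj_single h hv hw hl hc).symm
  have hk : ∀ z ∈ touched G g K l, 3 ≤ kap G K z := by
    intro z hz
    obtain ⟨v, hv, hz⟩ := mem_touched.1 hz
    have hz : z ∈ cnbr G g v l := by simpa using hz
    rcases F.card_cnbr_eq h hv hl with e | e
    · obtain ⟨c, hc⟩ := Finset.card_eq_one.1 e
      rw [hc, mem_singleton] at hz
      have := hsing v hv c hc
      subst hz
      omega
    · have := F.le_kap h hC hv hl hz e
      omega
  have hs : ∑ z ∈ touched G g K l, kap G K z = ∑ v ∈ K, (cnbr G g v l).card := sum_kap g K l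
  have hs10 : ∑ v ∈ K, (cnbr G g v l).card ≤ 10 := by
    refine (Finset.sum_le_card_nsmul _ _ 2 fun v _ => F.card_cnbr_le h hl v).trans ?_
    simp [hK]
  have hs9 : 9 ≤ ∑ v ∈ K, (cnbr G g v l).card := by
    by_cases hv : v₀ ∈ K
    · rw [← Finset.add_sum_erase K _ hv, Finset.sum_congr rfl fun u hu =>
        hv₀ u (Finset.mem_of_mem_erase hu) (Finset.ne_of_mem_erase hu) l hl]
      have := F.card_cnbr_pos h hv hl
      simp only [Finset.sum_const, Finset.card_erase_of_mem hv, hK, smul_eq_mul]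
      omega
    · rw [Finset.sum_congr rfl fun u hu => hv₀ u hu (fun e => hv (e ▸ hu)) l hl]
      simp [hK]
  by_cases h3 : ∃ a ∈ touched G g K l, kap G K a = 3
  · right
    obtain ⟨a, ha, hka⟩ := h3
    have hsa : kap G K a + ∑ z ∈ (touched G g K l).erase a, kap G K z =
        ∑ z ∈ touched G g K l, kap G K z := Finset.add_sum_erase _ _ ha
    have h2 : ∀ v ∈ K, (cnbr G g v l).card = 2 := by
      intro v hv
      refine (F.card_cnbr_eq h hv hl).resolve_left fun e => ?_
      obtain ⟨c, hc⟩ := Finset.card_eq_one.1 e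
      have hcT : c ∈ touched G g K l := mem_touched_of_mem hv (by simp [hc])
      have hkc := hsing v hv c hc
      have hca : c ∈ (touched G g K l).erase a := by
        rw [mem_erase]
        refine ⟨?_, hcT⟩
        rintro rfl
        omega
      have hsc := Finset.add_sum_erase _ (kap G K) hca
      have hlt : ∑ v ∈ K, (cnbr G g v l).card < 10 := by
        have : ∑ v ∈ K, (cnbr G g v l).card < ∑ v ∈ K, 2 :=
          Finset.sum_lt_sum (fun v _ => F.card_cnbr_le h hl v) ⟨v, hv, by omega⟩
        simpa [hK] using this
      -- The total would be exactly nine, so after the values `3` of `a` and `5` of `c` a remainder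
      -- of one is left; every touched vertex contributes at least three.
      rcases (((touched G g K l).erase a).erase c).eq_empty_or_nonempty with h0 | ⟨z, hz⟩
      · rw [h0, Finset.sum_empty] at hsc
        omega
      · have := Finset.single_le_sum (f := kap G K) (fun _ _ => Nat.zero_le _) hz
        have := hk z (Finset.mem_of_mem_erase (Finset.mem_of_mem_erase hz))
        omega
    have hsum : ∑ z ∈ touched G g K l, kap G K z = 10 := by
      rw [hs, Finset.sum_congr rfl h2]
      simp [hK]
    have hT : (touched G g K l).card • 3 ≤ 10 := hsum ▸ Finset.card_nsmul_le_sum _ _ _ hk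
    rw [smul_eq_mul] at hT
    refine ⟨h2, by omega, a, ha, ?_⟩
    -- The remaining values would be fours and fives with sum `10 - 3 = 7`.
    by_contra! hne
    have h4 : ∀ z ∈ (touched G g K l).erase a, 4 ≤ kap G K z := by
      intro z hz
      have h5 := hk z (Finset.mem_of_mem_erase hz)
      have h6 := hne z (Finset.mem_of_mem_erase hz) (Finset.ne_of_mem_erase hz).symm hka
      omega
    have h5 : _ ≤ ∑ z ∈ (touched G g K l).erase a, kap G K z := Finset.card_nsmul_le_sum _ _ _ h4
    have h6 : ∑ z ∈ (touched G g K l).erase a, kap G K z ≤ _ :=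
      Finset.sum_le_card_nsmul _ _ 5 fun z _ => hkle z
    simp only [smul_eq_mul] at h5 h6
    omega
  · left
    have h4 : ∀ z ∈ touched G g K l, 4 ≤ kap G K z := by
      intro z hz
      have := hk z hz
      have : kap G K z ≠ 3 := fun e => h3 ⟨z, hz, e⟩
      omega
    have h5 : _ ≤ ∑ z ∈ touched G g K l, kap G K z := Finset.card_nsmul_le_sum _ _ _ h4
    have h5' : ∑ z ∈ touched G g K l, kap G K z ≤ _ :=
      Finset.sum_le_card_nsmul _ _ 5 fun z _ => hkle z
    rw [smul_eq_mul] at h5 h5'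
    have h6 : ∀ u ∈ K, u ≠ v₀ → cnbr G g u l = touched G g K l := by
      intro u hu hne
      apply Finset.eq_of_subset_of_card_le
      · exact fun z hz => mem_touched_of_mem hu hz
      · rw [hv₀ u hu hne l hl]
        omega
    intro u hu v hv hu0 hv0
    rw [h6 u hu hu0, h6 v hv hv0]

/-- Away from one vertex `v₀`, all colours of `L` but one have the same neighbours at every vertex
of `K`. At some `x` of `K`, the perfect matching of non-edges must send three vertices of `K` into
the exceptional colour, which has only two vertices there. -/
theorem card_ne_five (F : Flex G g K L) (h : Crit G C) (hC : Fintype.card C = 8) :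
    K.card ≠ 5 := by
  intro hK
  have hL : L.card = 3 := by have := F.card; omega
  -- single colours occur at one vertex only
  have h1 : ∀ u ∈ K, ∀ v ∈ K, u ≠ v → ∀ l ∈ L, ∀ l' ∈ L, (cnbr G g u l).card = 1 →
      (cnbr G g v l').card ≠ 1 := by
    intro u hu v hv huv l hl l' hl' e e'
    by_cases hll : l = l'
    · subst hll
      obtain ⟨c, hc, F'⟩ := F.extend h hu hv huv hl e e'
      exact F'.card_ne_six h hC (by rw [Finset.card_insert_of_notMem hc, hK])
    · obtain ⟨c, hc⟩ := Finset.card_eq_one.1 e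
      obtain ⟨c', hc'⟩ := Finset.card_eq_one.1 e'
      have hcc := F.single_adj_single h hu hv huv hl hl' hll hc hc'
      refine F.not_complete h hC (S := {c, c'}) ?_ ?_ ?_
      · rw [Finset.card_pair hcc.ne, hK]
      · intro s hs w hw
        simp only [mem_insert, mem_singleton] at hs
        rcases hs with rfl | rfl
        · exact F.adj_single h hu hw hl hc
        · exact F.adj_single h hv hw hl' hc'
      · intro s hs t ht hst
        simp only [mem_insert, mem_singleton] at hs ht
        rcases hs with rfl | rfl <;> rcases ht with rfl | rfl
        · exact absurd rfl hst
        · exact hcc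
        · exact hcc.symm
        · exact absurd rfl hst
  obtain ⟨v₀, hv₀⟩ : ∃ v₀, ∀ u ∈ K, u ≠ v₀ → ∀ l ∈ L, (cnbr G g u l).card = 2 := by
    by_cases hex : ∃ v ∈ K, ∃ l ∈ L, (cnbr G g v l).card = 1
    · obtain ⟨v, hv, l, hl, e⟩ := hex
      exact ⟨v, fun u hu huv l' hl' =>
        (F.card_cnbr_eq h hu hl').resolve_left (h1 v hv u hu huv.symm l hl l' hl' e)⟩
    · obtain ⟨v, hv⟩ := Finset.card_pos.1 (by omega : 0 < K.card)
      exact ⟨v, fun u hu huv l' hl' =>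
        (F.card_cnbr_eq h hu hl').resolve_left fun e => hex ⟨u, hu, l', hl', e⟩⟩
  -- at most one colour is not constant
  obtain ⟨l₀, hl₀L, hl₀⟩ : ∃ l₀ ∈ L, ∀ l ∈ L, l ≠ l₀ →
      ∀ u ∈ K, ∀ v ∈ K, u ≠ v₀ → v ≠ v₀ → cnbr G g u l = cnbr G g v l := by
    by_contra! hne
    obtain ⟨l₁, hl₁⟩ := Finset.card_pos.1 (by omega : 0 < L.card)
    obtain ⟨l, hl, -, u, hu, v, hv, hu0, hv0, huv⟩ := hne l₁ hl₁
    obtain ⟨l', hl', hll, u', hu', v', hv', hu0', hv0', huv'⟩ := hne l hl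
    obtain ⟨h2, hT, a, ha, b, hb, hab, hka, hkb⟩ :=
      (F.const_or_exists h hC hK hv₀ hl).resolve_left fun hc => huv (hc u hu v hv hu0 hv0)
    obtain ⟨h2', -, a', ha', -, -, -, hka', -⟩ :=
      (F.const_or_exists h hC hK hv₀ hl').resolve_left fun hc => huv' (hc u' hu' v' hv' hu0' hv0')
    -- A second non-constant colour would have a touched vertex with three neighbours in `K`,
    -- although `kap_eq` gives it five.
    have := F.kap_eq h hC hK.ge hl hl' hll h2 h2' hT ha hb hab (by omega) (by omega) a' ha'
    omega
  obtain ⟨x, hx, hx0⟩ := Finset.exists_mem_ne (by omega : 1 < K.card) v₀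
  obtain ⟨p, hp, hpi⟩ := h.exists_matching hC x
  have hN : nbr G x = K.erase x ∪ L.biUnion (fun l => cnbr G g x l) := by
    symm
    apply Finset.eq_of_subset_of_card_le (F.union_subset h hx)
    rw [F.card_union, Finset.card_erase_of_mem hx, Finset.sum_congr rfl (hv₀ x hx hx0),
      h.card_nbr_eq_ten hC]
    simp [hK, hL]
  let U := (K.erase x).erase v₀
  have hU : 3 ≤ U.card := by
    have := Finset.pred_card_le_card_erase (s := K.erase x) (a := v₀)
    rw [Finset.card_erase_of_mem hx] at this
    simp only [U]
    omega
  have hUK : ∀ u ∈ U, u ∈ K ∧ u ≠ x ∧ u ≠ v₀ := by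
    intro u hu
    simp only [U, mem_erase] at hu
    exact ⟨hu.2.2, hu.2.1, hu.1⟩
  have hU' : U.card ≤ (cnbr G g x l₀).card := by
    apply Finset.card_le_card_of_injOn p
    · intro u hu
      obtain ⟨hu, hux, hu0⟩ := hUK u hu
      obtain ⟨h3, h4⟩ := hp u (F.adj h hx hu hux.symm)
      have h5 : p u ∈ nbr G x := by simpa using h3
      rw [hN, mem_union, mem_biUnion] at h5
      rcases h5 with h5 | ⟨l, hl, h5⟩
      · exact absurd (F.adj h hu (Finset.mem_of_mem_erase h5) h4.1) h4.2
      · by_cases hll : l = l₀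
        · subst hll; exact h5
        · rw [hl₀ l hl hll x hx u hu hx0 hu0] at h5
          exact absurd (mem_cnbr.1 h5).1 h4.2
    · intro u hu v hv e
      have hu := hUK u hu
      have hv := hUK v hv
      exact hpi u v (F.adj h hx hu.1 hu.2.1.symm) (F.adj h hx hv.1 hv.2.1.symm) e
  rw [hv₀ x hx hx0 l₀ hl₀L] at hU'
  omega

/-- Each vertex of `K` has a single colour, and these colours differ since a shared one would extend
`K`. Their four vertices are adjacent to each other and to all of `K`. -/
theorem card_ne_four (F : Flex G g K L) (h : Crit G C) (hC : Fintype.card C = 8) :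
    K.card ≠ 4 := by
  intro hK
  have h1 : ∀ u ∈ K, ∃ l ∈ L, ∃ c, cnbr G g u l = {c} := by
    intro u hu
    have := F.le_card_singles h hC hu
    obtain ⟨l, hl⟩ := Finset.card_pos.1
      (by omega : 0 < (L.filter fun l => (cnbr G g u l).card = 1).card)
    rw [mem_filter] at hl
    exact ⟨l, hl.1, Finset.card_eq_one.1 hl.2⟩
  obtain ⟨v, hv⟩ := Finset.card_pos.1 (by omega : 0 < K.card)
  have : Nonempty V := ⟨v⟩
  have : Nonempty C := ⟨g v⟩
  choose! l hl c hc using h1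
  have hll : ∀ u ∈ K, ∀ v ∈ K, u ≠ v → l u ≠ l v := by
    intro u hu v hv huv e
    obtain ⟨c', hc', F'⟩ := F.extend h hu hv huv (hl u hu) (by simp [hc u hu])
      (by simp [e, hc v hv])
    exact F'.card_ne_five h hC (by rw [Finset.card_insert_of_notMem hc', hK])
  refine F.not_complete h hC (S := K.image c) ?_ ?_ ?_
  · rw [Finset.card_image_of_injOn, hK]
    · norm_num
    intro u hu v hv e
    by_contra huv
    refine hll u hu v hv huv ?_
    rw [← color_of_single (hc u hu), ← color_of_single (hc v hv), e]
  · intro s hs w hw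
    rw [mem_image] at hs
    obtain ⟨u, hu, rfl⟩ := hs
    exact F.adj_single h hu hw (hl u hu) (hc u hu)
  · intro s hs t ht hst
    rw [mem_image] at hs ht
    obtain ⟨u, hu, rfl⟩ := hs
    obtain ⟨v, hv, rfl⟩ := ht
    have huv : u ≠ v := fun e => hst (e ▸ rfl)
    exact F.single_adj_single h hu hv huv (hl u hu) (hl v hv) (hll u hu v hv huv) (hc u hu) (hc v hv)

/-- Each vertex has at least two single colours and none is shared, but only five colours are
available. -/
theorem card_ne_three (F : Flex G g K L) (h : Crit G C) (hC : Fintype.card C = 8) :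
    K.card ≠ 3 := by
  intro hK
  let S : V → Finset C := fun u => L.filter fun l => (cnbr G g u l).card = 1
  have h1 : K.card • 2 ≤ ∑ u ∈ K, (S u).card := by
    refine Finset.card_nsmul_le_sum _ _ _ fun u hu => ?_
    have := F.le_card_singles h hC hu
    simp only [S]
    omega
  rw [← Finset.card_biUnion] at h1
  · have h2 : (K.biUnion S).card ≤ L.card :=
      Finset.card_le_card (Finset.biUnion_subset.2 fun u _ => Finset.filter_subset _ _)
    have := F.card
    rw [smul_eq_mul] at h1
    omega
  · intro u hu v hv huv
    rw [Function.onFun, Finset.disjoint_left]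
    intro l hl hl'
    simp only [S, mem_filter] at hl hl'
    obtain ⟨c', hc', F'⟩ := F.extend h hu hv huv hl.1 hl.2 hl'.2
    exact F'.card_ne_four h hC (by rw [Finset.card_insert_of_notMem hc', hK])

end Flex

/-- A colour cannot be single for both vertices of a state. -/
theorem Crit.disjoint_singles (h : Crit G C) (hC : Fintype.card C = 8) (s : State G f x y) :
    Disjoint (singles G f x y) (singles G f y x) := by
  have hK : ({x, y} : Finset V).card = 2 := Finset.card_pair s.ne
  have hL := Finset.card_add_card_compl ({f x, f y} : Finset C)
  rw [Finset.card_pair s.color_ne] at hL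
  have F : Flex G f {x, y} ({f x, f y} : Finset C)ᶜ := by
    refine ⟨by rw [hK, hL], hK.ge, ?_, ?_⟩
    · intro z hz
      simp only [mem_insert, mem_singleton] at hz
      rcases hz with rfl | rfl <;> simp
    · intro u hu v hv huv
      simp only [mem_insert, mem_singleton] at hu hv
      rcases hu with rfl | rfl <;> rcases hv with rfl | rfl
      · exact absurd rfl huv
      · exact ⟨f, s, fun _ _ _ => Iff.rfl⟩
      · exact ⟨f, s.symm, fun _ _ _ => Iff.rfl⟩
      · exact absurd rfl huv
  rw [Finset.disjoint_left]
  intro j hx hy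
  simp only [singles, mem_filter, mem_univ, true_and] at hx hy
  obtain ⟨c, hc, F'⟩ := F.extend h (u := x) (v := y) (by simp) (by simp) s.ne (l := j)
    (by simp [hx.1, hy.1]) hx.2 hy.2
  exact F'.card_ne_three h hC (by rw [Finset.card_insert_of_notMem hc, hK])

end DoubleCritical

/-! ### The single colours at the two ends of a state. -/

namespace DoubleCritical

set_option linter.unusedSectionVars false

open Finset
open scoped Classical

variable {V C : Type*} {G : SimpleGraph V} {f : V → C} {x y : V} [Fintype V] [Fintype C]

theorem cnbr_move {a : V} (w : V) {j : C} (hjx : j ≠ f x) (hja : j ≠ f a) :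
    cnbr G (f ∘ Equiv.swap x a) w j = cnbr G f w j := by
  ext z
  simp only [mem_cnbr, move_apply]
  by_cases hx : z = x
  · subst hx
    simp [hjx.symm, hja.symm]
  · by_cases ha : z = a
    · subst ha
      simp [hx, hjx.symm, hja.symm]
    · simp [hx, ha]

theorem mem_singles {j : C} : j ∈ singles G f x y ↔ j ≠ f y ∧ (cnbr G f x j).card = 1 := by
  simp [singles]

theorem State.ne_of_mem_singles (s : State G f x y) {j : C} (hj : j ∈ singles G f x y) :
    j ≠ f x := by
  rintro rfl
  have := (mem_singles.1 hj).2
  rw [s.card_cnbr_self] at this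
  omega

theorem unique_of_single {a : V} (ha : G.Adj x a) (hA : f a ∈ singles G f x y) :
    ∀ z, G.Adj x z → f z = f a → z = a := fun z hz e =>
  Finset.card_le_one.1 (mem_singles.1 hA).2.le z (by simp [hz, e]) a (by simp [ha])

theorem Crit.card_singles_eq_three (h : Crit G C) (hC : Fintype.card C = 8)
    (s : State G f x y) : (singles G f x y).card = 3 := by
  have := h.card_singles s
  have := h.card_nbr_eq_ten hC x
  omega

/-- The two disjoint triples of single colours exhaust the six colours other than `f x` and `f y`.
-/
theorem Crit.mem_singles_of_notMem (h : Crit G C) (hC : Fintype.card C = 8)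
    (s : State G f x y) {j : C} (hx : j ≠ f x) (hy : j ≠ f y) (hj : j ∉ singles G f y x) :
    j ∈ singles G f x y := by
  have h1 : singles G f x y ∪ singles G f y x = ({f x, f y} : Finset C)ᶜ := by
    apply Finset.eq_of_subset_of_card_le
    · intro k
      simp only [mem_union, mem_compl, mem_insert, mem_singleton, not_or]
      rintro (hk | hk)
      · exact ⟨s.ne_of_mem_singles hk, (mem_singles.1 hk).1⟩
      · exact ⟨(mem_singles.1 hk).1, s.symm.ne_of_mem_singles hk⟩
    · rw [Finset.card_union_of_disjoint (h.disjoint_singles hC s), h.card_singles_eq_three hC s,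
        h.card_singles_eq_three hC s.symm]
      have := Finset.card_add_card_compl ({f x, f y} : Finset C)
      rw [Finset.card_pair s.color_ne] at this
      omega
  have h2 : j ∈ singles G f x y ∪ singles G f y x := by simp [h1, hx, hy]
  exact (mem_union.1 h2).resolve_right hj

/-- The move alters only the classes of `f x` and `f a`, neither of which is single for `y`, so the
triple at `y` persists. The triple at the other end is its complement among the six colours and
persists too. -/
theorem Crit.move_singles (h : Crit G C) (hC : Fintype.card C = 8) (s : State G f x y) {a : V}
    (ha : G.Adj x a) (hA : f a ∈ singles G f x y) :
    State G (f ∘ Equiv.swap x a) a y ∧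
      singles G (f ∘ Equiv.swap x a) a y = singles G f x y ∧
      singles G (f ∘ Equiv.swap x a) y a = singles G f y x := by
  have s' : State G (f ∘ Equiv.swap x a) a y :=
    s.move (mem_singles.1 hA).1 ha.ne' (unique_of_single ha hA)
  have hay : a ≠ y := by
    rintro rfl
    exact (mem_singles.1 hA).1 rfl
  have ea : (f ∘ Equiv.swap x a) a = f x := by simp
  have ey : (f ∘ Equiv.swap x a) y = f y := by
    rw [move_apply, if_neg s.ne.symm, if_neg hay.symm]
  have h1 : singles G (f ∘ Equiv.swap x a) y a = singles G f y x := by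
    symm
    apply Finset.eq_of_subset_of_card_le
    · intro j hj
      have hja : j ≠ f a := fun e =>
        Finset.disjoint_left.1 (h.disjoint_singles hC s) hA (e ▸ hj)
      rw [mem_singles] at hj ⊢
      rw [ea, cnbr_move y hj.1 hja]
      exact hj
    · rw [h.card_singles_eq_three hC s.symm, h.card_singles_eq_three hC s'.symm]
  refine ⟨s', ?_, h1⟩
  symm
  apply Finset.eq_of_subset_of_card_le
  · intro j hj
    apply h.mem_singles_of_notMem hC s'
    · rw [ea]; exact s.ne_of_mem_singles hj
    · rw [ey]; exact (mem_singles.1 hj).1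
    · rw [h1]
      exact Finset.disjoint_left.1 (h.disjoint_singles hC s) hj
  · rw [h.card_singles_eq_three hC s, h.card_singles_eq_three hC s']

/-- Vertices with single colours for the different ends of a state are adjacent. -/
theorem Crit.adj_singles (h : Crit G C) (hC : Fintype.card C = 8) (s : State G f x y) {a b : V}
    (ha : G.Adj x a) (hA : f a ∈ singles G f x y) (hb : G.Adj y b)
    (hB : f b ∈ singles G f y x) : G.Adj a b := by
  refine h.adj_of_singles s ha (unique_of_single ha hA) hb (unique_of_single hb hB) ?_ ?_ ?_
  · rintro rfl; exact (mem_singles.1 hA).1 rfl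
  · rintro rfl; exact (mem_singles.1 hB).1 rfl
  · exact fun e => Finset.disjoint_left.1 (h.disjoint_singles hC s) hA (e ▸ hB)

theorem Crit.adj_left_of_single (h : Crit G C) (s : State G f x y) {b : V}
    (hb : G.Adj y b) (hB : f b ∈ singles G f y x) : G.Adj x b := by
  obtain ⟨v, h1, h2, h3⟩ := h.exists_common s (mem_singles.1 hB).1 (s.symm.ne_of_mem_singles hB)
  exact unique_of_single hb hB v h2 h3 ▸ h1

/-- A neighbour `a` of `x` with a single colour has just one neighbour of each other single
colour. -/
theorem Crit.unique_of_move (h : Crit G C) (hC : Fintype.card C = 8) (s : State G f x y) {a : V}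
    (ha : G.Adj x a) (hA : f a ∈ singles G f x y) {j : C} (hj : j ∈ singles G f x y)
    (hja : j ≠ f a) : (cnbr G f a j).card = 1 := by
  obtain ⟨-, h1, -⟩ := h.move_singles hC s ha hA
  have hjx := s.ne_of_mem_singles hj
  rw [← h1, mem_singles, cnbr_move a hjx hja] at hj
  exact hj.2

theorem Crit.unique_of_move_move (h : Crit G C) (hC : Fintype.card C = 8) (s : State G f x y)
    {a c : V} (ha : G.Adj x a) (hA : f a ∈ singles G f x y) (hc : G.Adj a c)
    (hcA : f c ∈ singles G f x y) {j : C} (hj : j ∈ singles G f x y)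
    (hja : j ≠ f a) (hjc : j ≠ f c) : (cnbr G f c j).card = 1 := by
  obtain ⟨s', h1, -⟩ := h.move_singles hC s ha hA
  have hca : c ≠ a := hc.ne'
  have hcx : c ≠ x := by
    rintro rfl
    exact s.ne_of_mem_singles hcA rfl
  have ec : (f ∘ Equiv.swap x a) c = f c := by rw [move_apply, if_neg hcx, if_neg hca]
  have h2 := h.unique_of_move hC s' hc (by rwa [h1, ec]) (h1.symm ▸ hj) (by rwa [ec])
  rwa [cnbr_move c (s.ne_of_mem_singles hj) hja] at h2

/-- After moving `y` to `b`, the colour `j` still belongs to the other triple, so it is not single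
for `b`; yet it must occur near `b`. -/
theorem Crit.card_cnbr_of_single (h : Crit G C) (hC : Fintype.card C = 8) (s : State G f x y)
    {b : V} (hb : G.Adj y b) (hB : f b ∈ singles G f y x) {j : C}
    (hj : j ∈ singles G f x y) : (cnbr G f b j).card = 2 := by
  obtain ⟨s', h1, -⟩ := h.move_singles hC s.symm hb hB
  have hd := Finset.disjoint_left.1 (h.disjoint_singles hC s) hj
  have hjb : j ≠ f b := fun e => hd (e ▸ hB)
  have hjy := (mem_singles.1 hj).1
  have hjx := s.ne_of_mem_singles hj
  have hbx : b ≠ x := by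
    rintro rfl
    exact (mem_singles.1 hB).1 rfl
  have eb : (f ∘ Equiv.swap y b) b = f y := by simp
  have ex : (f ∘ Equiv.swap y b) x = f x := by rw [move_apply, if_neg s.ne, if_neg hbx.symm]
  have h2 := h.card_cnbr_pos s' (j := j) (by rwa [eb]) (by rwa [ex])
  have h3 := h.card_cnbr_le s'.proper b j
  have h4 : (cnbr G (f ∘ Equiv.swap y b) b j).card ≠ 1 := by
    intro e
    rw [← h1, mem_singles, ex] at hd
    exact hd ⟨hjx, e⟩
  rw [cnbr_move b hjy hjb] at h2 h3 h4
  omega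

/-- The neighbours of `x` with single colours form a clique. -/
theorem Crit.singles_adj (h : Crit G C) (hC : Fintype.card C = 8) (s : State G f x y)
    {a₁ a₂ : V} (ha₁ : G.Adj x a₁) (ha₂ : G.Adj x a₂) (hA₁ : f a₁ ∈ singles G f x y)
    (hA₂ : f a₂ ∈ singles G f x y) (hne : a₁ ≠ a₂) : G.Adj a₁ a₂ := by
  by_contra hn
  have h12 : f a₁ ≠ f a₂ := fun e => hne (unique_of_single ha₂ hA₂ a₁ ha₁ e)
  obtain ⟨a₃, ha₃, hA₃, h13, h23⟩ : ∃ a₃, G.Adj x a₃ ∧ f a₃ ∈ singles G f x y ∧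
      f a₁ ≠ f a₃ ∧ f a₂ ≠ f a₃ := by
    have h1 : ({f a₁, f a₂} : Finset C).card < (singles G f x y).card := by
      rw [h.card_singles_eq_three hC s, Finset.card_pair h12]
      norm_num
    obtain ⟨j, hj, hj'⟩ := Finset.exists_mem_notMem_of_card_lt_card h1
    obtain ⟨v, h2, -, rfl⟩ := h.exists_common s (s.ne_of_mem_singles hj) (mem_singles.1 hj).1
    simp only [mem_insert, mem_singleton, not_or] at hj'
    exact ⟨v, h2, hj, fun e => hj'.1 e.symm, fun e => hj'.2 e.symm⟩
  obtain ⟨b, hb, hB⟩ : ∃ b, G.Adj y b ∧ f b ∈ singles G f y x := by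
    obtain ⟨j, hj⟩ := Finset.card_pos.1
      (by rw [h.card_singles_eq_three hC s.symm]; norm_num : 0 < (singles G f y x).card)
    obtain ⟨v, -, h2, rfl⟩ := h.exists_common s (mem_singles.1 hj).1
      (s.symm.ne_of_mem_singles hj)
    exact ⟨v, h2, hj⟩
  have hxb : G.Adj x b := h.adj_left_of_single s hb hB
  -- the second neighbours of `b` in the classes of the `aᵢ`
  have second : ∀ a, G.Adj x a → f a ∈ singles G f x y →
      ∃ t, G.Adj b t ∧ f t = f a ∧ ¬ G.Adj x t ∧ t ≠ x ∧
        ∀ z, G.Adj b z → f z = f a → z = a ∨ z = t := by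
    intro a ha hA
    have h1 := h.card_cnbr_of_single hC s hb hB hA
    have h2 : a ∈ cnbr G f b (f a) := by simp [(h.adj_singles hC s ha hA hb hB).symm]
    obtain ⟨t, ht, hta⟩ := Finset.exists_mem_ne (by omega : 1 < (cnbr G f b (f a)).card) a
    have ht' := mem_cnbr.1 ht
    refine ⟨t, ht'.1, ht'.2, fun e => hta (unique_of_single ha hA t e ht'.2), ?_, ?_⟩
    · rintro rfl
      exact s.ne_of_mem_singles hA ht'.2.symm
    · intro z hz e
      by_contra! hne
      have h3 : ({z, a, t} : Finset V) ⊆ cnbr G f b (f a) := by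
        intro w
        simp only [mem_insert, mem_singleton]
        rintro (rfl | rfl | rfl)
        · simp [hz, e]
        · exact h2
        · exact ht
      have h4 := Finset.card_le_card h3
      rw [Finset.card_eq_three.2 ⟨z, a, t, hne.1, hne.2, hta.symm, rfl⟩] at h4
      omega
  -- the only neighbour of `a` in the class of `a'`
  have step : ∀ a a' t, G.Adj x a → f a ∈ singles G f x y → f a' ∈ singles G f x y →
      f a' ≠ f a → (∀ z, G.Adj b z → f z = f a' → z = a' ∨ z = t) →
      G.Adj a a' ∨ G.Adj a t := by
    intro a a' t ha hA hA' hne ht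
    obtain ⟨s', h1, h2⟩ := h.move_singles hC s ha hA
    have h3 := h.unique_of_move hC s ha hA hA' hne
    obtain ⟨c, hc⟩ := Finset.card_eq_one.1 h3
    have hc' : c ∈ cnbr G f a (f a') := by simp [hc]
    rw [mem_cnbr] at hc'
    have hcx : c ≠ x := by
      rintro rfl
      exact s.ne_of_mem_singles hA' hc'.2.symm
    have ec : (f ∘ Equiv.swap x a) c = f c := by rw [move_apply, if_neg hcx, if_neg hc'.1.ne']
    have eb : (f ∘ Equiv.swap x a) b = f b := by
      rw [move_apply, if_neg hxb.ne', if_neg (h.adj_singles hC s ha hA hb hB).ne']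
    have hcb : G.Adj c b :=
      h.adj_singles hC s' hc'.1 (by rwa [h1, ec, hc'.2]) hb (by rwa [h2, eb])
    rcases ht c hcb.symm hc'.2 with rfl | rfl
    · exact Or.inl hc'.1
    · exact Or.inr hc'.1
  have hclaw : ∀ t t', G.Adj b t → G.Adj b t' → ¬ G.Adj x t → ¬ G.Adj x t' → t ≠ x → t' ≠ x →
      t ≠ t' → G.Adj t t' := fun t t' h1 h2 h3 h4 h5 h6 h7 =>
    h.claw hxb.symm h1 h2 h5.symm h6.symm h7 h3 h4
  obtain ⟨t₁, hbt₁, et₁, hxt₁, htx₁, hu₁⟩ := second a₁ ha₁ hA₁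
  obtain ⟨t₂, hbt₂, et₂, hxt₂, htx₂, hu₂⟩ := second a₂ ha₂ hA₂
  obtain ⟨t₃, hbt₃, et₃, hxt₃, htx₃, hu₃⟩ := second a₃ ha₃ hA₃
  have n13 : t₁ ≠ t₃ := by rintro rfl; exact h13 (et₁.symm.trans et₃)
  have n23 : t₂ ≠ t₃ := by rintro rfl; exact h23 (et₂.symm.trans et₃)
  have at3 : a₃ ≠ t₃ := by rintro rfl; exact hxt₃ ha₃
  have ht13 := hclaw t₁ t₃ hbt₁ hbt₃ hxt₁ hxt₃ htx₁ htx₃ n13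
  have ht23 := hclaw t₂ t₃ hbt₂ hbt₃ hxt₂ hxt₃ htx₂ htx₃ n23
  have h1t2 : G.Adj a₁ t₂ := (step a₁ a₂ t₂ ha₁ hA₁ hA₂ h12.symm hu₂).resolve_left hn
  have h2t1 : G.Adj a₂ t₁ :=
    (step a₂ a₁ t₁ ha₂ hA₂ hA₁ h12 hu₁).resolve_left fun e => hn e.symm
  -- Moving `x` to `a₂` and on to `t₁` shows that `t₁` has one neighbour in the class of `a₃`; it
  -- already has `t₃`.
  have h3a : ¬ G.Adj a₃ t₁ := by
    intro e
    have h1 := h.unique_of_move_move hC s ha₂ hA₂ h2t1 (et₁ ▸ hA₁) hA₃ h23.symm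
      (et₁ ▸ h13.symm)
    exact at3 (Finset.card_le_one.1 h1.le a₃ (by simp [e.symm]) t₃ (by simp [ht13, et₃]))
  have h3b : ¬ G.Adj a₃ t₂ := by
    intro e
    have h1 := h.unique_of_move_move hC s ha₁ hA₁ h1t2 (et₂ ▸ hA₂) hA₃ h13.symm
      (et₂ ▸ h23.symm)
    exact at3 (Finset.card_le_one.1 h1.le a₃ (by simp [e.symm]) t₃ (by simp [ht23, et₃]))
  have h31 : G.Adj a₁ a₃ := ((step a₃ a₁ t₁ ha₃ hA₃ hA₁ h13 hu₁).resolve_right h3a).symm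
  have h32 : G.Adj a₂ a₃ := ((step a₃ a₂ t₂ ha₃ hA₃ hA₂ h23 hu₂).resolve_right h3b).symm
  have k1 : ¬ G.Adj a₁ t₃ := by
    intro e
    have h1 := h.unique_of_move hC s ha₁ hA₁ hA₃ h13.symm
    exact at3 (Finset.card_le_one.1 h1.le a₃ (by simp [h31]) t₃ (by simp [e, et₃]))
  have k2 : ¬ G.Adj a₂ t₃ := by
    intro e
    have h1 := h.unique_of_move hC s ha₂ hA₂ hA₃ h23.symm
    exact at3 (Finset.card_le_one.1 h1.le a₃ (by simp [h32]) t₃ (by simp [e, et₃]))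
  -- `b` with `a₁`, `a₂`, `t₃` would be a claw.
  refine k2 (h.claw (h.adj_singles hC s ha₁ hA₁ hb hB).symm
    (h.adj_singles hC s ha₂ hA₂ hb hB).symm hbt₃ hne ?_ ?_ hn k1)
  · rintro rfl; exact hxt₃ ha₁
  · rintro rfl; exact hxt₃ ha₂

theorem Crit.card_gt (h : Crit G C) (v : V) : 8 < Fintype.card C := by
  by_contra! hle
  have hC := h.card_eq_eight hle v
  obtain ⟨w, hvw⟩ := h.noniso v
  obtain ⟨f, s⟩ := h.state hvw
  obtain ⟨A, hA, hA'⟩ := h.exists_card_singles s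
  obtain ⟨B, hB, hB'⟩ := h.exists_card_singles s.symm
  rw [h.card_singles_eq_three hC s] at hA
  rw [h.card_singles_eq_three hC s.symm] at hB
  have hAB : ∀ a ∈ A, ∀ b ∈ B, G.Adj a b := fun a ha b hb =>
    h.adj_singles hC s (hA' a ha).1 (hA' a ha).2.2.1 (hB' b hb).1 (hB' b hb).2.2.1
  have hd : Disjoint A B := by
    rw [Finset.disjoint_left]
    exact fun z hz hz' => (hAB z hz z hz').ne rfl
  have hvA : v ∉ A ∪ B := by
    simp only [mem_union, not_or]
    exact ⟨fun hv => (hA' v hv).1.ne rfl, fun hv => (hB' v hv).2.1.ne rfl⟩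
  have := h.card_clique_le (K := insert v (A ∪ B)) (by
    have hv : ∀ z ∈ A ∪ B, G.Adj v z := by
      intro z hz
      rcases mem_union.1 hz with hz | hz
      · exact (hA' z hz).1
      · exact (hB' z hz).2.1
    have hz : ∀ z ∈ A ∪ B, ∀ z' ∈ A ∪ B, z ≠ z' → G.Adj z z' := by
      intro z hz z' hz' hne
      rcases mem_union.1 hz with hz | hz <;> rcases mem_union.1 hz' with hz' | hz'
      · exact h.singles_adj hC s (hA' z hz).1 (hA' z' hz').1 (hA' z hz).2.2.1 (hA' z' hz').2.2.1 hne
      · exact hAB z hz z' hz'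
      · exact (hAB z' hz' z hz).symm
      · exact h.singles_adj hC s.symm (hB' z hz).1 (hB' z' hz').1 (hB' z hz).2.2.1
          (hB' z' hz').2.2.1 hne
    intro a ha b hb hab
    rcases mem_insert.1 ha with rfl | ha' <;> rcases mem_insert.1 hb with rfl | hb'
    · exact absurd rfl hab
    · exact hv b hb'
    · exact (hv a ha').symm
    · exact hz a ha' b hb' hab) ⟨v, by simp⟩
  rw [Finset.card_insert_of_notMem hvA, Finset.card_union_of_disjoint hd] at this
  omega

end DoubleCritical

/-! ### From the chromatic number to the working form; removing universal vertices. -/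

namespace DoubleCritical

open Finset
open scoped Classical

variable {V : Type*} {G : SimpleGraph V} {t : ℕ}

theorem surjective_of_chromaticNumber (hχ : G.chromaticNumber = (t : ℕ∞)) {C : Type*} [Fintype C]
    (hC : Fintype.card C = t) (f : V → C) (hf : Proper G f) : Function.Surjective f := by
  intro c
  by_contra! hc
  let g : G.Coloring {d : C // d ≠ c} := SimpleGraph.Coloring.mk (fun v => ⟨f v, hc v⟩) (by
    intro u v huv e
    exact hf huv (congrArg Subtype.val e))
  have h1 := g.colorable.chromaticNumber_le
  have h2 : Fintype.card {d : C // d ≠ c} = t - 1 := by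
    rw [Fintype.card_subtype_compl, Fintype.card_subtype_eq, hC]
  have h3 : 0 < Fintype.card C := Fintype.card_pos_iff.2 ⟨c⟩
  rw [hχ, h2, Nat.cast_le] at h1
  omega

theorem exists_state (hχ : G.chromaticNumber = (t : ℕ∞)) (hdc : G.IsDoubleCritical) {x y : V}
    (hxy : G.Adj x y) : ∃ f : V → Fin t, State G f x y := by
  have h1 := hdc.2 x y hxy
  rw [hχ] at h1
  obtain ⟨n, hn⟩ : ∃ n : ℕ, (G.induce ({x, y}ᶜ : Set V)).chromaticNumber = n := by
    -- An infinite chromatic number of the smaller graph would make `t` infinite.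
    refine ⟨_, (ENat.natCast_toNat fun e => ?_).symm⟩
    rw [e] at h1
    exact ENat.natCast_ne_top t (by simpa using h1.symm)
  rw [hn] at h1
  have hnt : n + 2 = t := by exact_mod_cast h1
  subst hnt
  have hcol : (G.induce ({x, y}ᶜ : Set V)).Colorable n :=
    SimpleGraph.chromaticNumber_le_iff_colorable.1 hn.le
  obtain ⟨g⟩ := hcol
  have hmem : ∀ v, v ≠ x → v ≠ y → v ∈ ({x, y}ᶜ : Set V) := by
    intro v h1 h2
    simp [h1, h2]
  let f : V → ℕ := fun v => if hx : v = x then n else if hy : v = y then n + 1 else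
    (g ⟨v, hmem v hx hy⟩ : ℕ)
  have fx : f x = n := by simp [f]
  have fy : f y = n + 1 := by simp [f, hxy.ne']
  have fv : ∀ v (hx : v ≠ x) (hy : v ≠ y), f v = g ⟨v, hmem v hx hy⟩ := by
    intro v hx hy
    simp [f, hx, hy]
  have flt : ∀ v, v ≠ x → v ≠ y → f v < n := by
    intro v hx hy
    rw [fv v hx hy]
    exact (g _).2
  have hf : ∀ v, f v < n + 2 := by
    intro v
    by_cases hx : v = x
    · subst hx; omega
    by_cases hy : v = y
    · subst hy; omega
    have := flt v hx hy
    omega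
  have hl : ∀ v, f v = n → v = x := by
    intro v e
    by_contra hx
    by_cases hy : v = y
    · subst hy; omega
    have := flt v hx hy
    omega
  have hr : ∀ v, f v = n + 1 → v = y := by
    intro v e
    by_contra hy
    by_cases hx : v = x
    · subst hx; omega
    have := flt v hx hy
    omega
  refine ⟨fun v => ⟨f v, hf v⟩, ?_, hxy.ne, ?_, ?_⟩
  · intro u v huv e
    have e : f u = f v := congrArg Fin.val e
    by_cases hux : u = x
    · rw [hux, fx] at e
      exact huv.ne (hux.trans (hl v e.symm).symm)
    by_cases huy : u = y
    · rw [huy, fy] at e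
      exact huv.ne (huy.trans (hr v e.symm).symm)
    by_cases hvx : v = x
    · rw [hvx, fx] at e
      exact hux (hl u e)
    by_cases hvy : v = y
    · rw [hvy, fy] at e
      exact huy (hr u e)
    rw [fv u hux huy, fv v hvx hvy] at e
    exact g.valid (v := ⟨u, hmem u hux huy⟩) (w := ⟨v, hmem v hvx hvy⟩) huv (Fin.ext e)
  · intro v e
    exact hl v ((congrArg Fin.val e).trans fx)
  · intro v e
    exact hr v ((congrArg Fin.val e).trans fy)

theorem adj_of_clawFree (hcf : G.IsClawFree) {v a b c : V} (ha : G.Adj v a) (hb : G.Adj v b)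
    (hc : G.Adj v c) (hab : a ≠ b) (hac : a ≠ c) (hbc : b ≠ c) (nab : ¬ G.Adj a b)
    (nac : ¬ G.Adj a c) : G.Adj b c := by
  by_contra nbc
  let φ : Fin 1 ⊕ Fin 3 → V := Sum.elim (fun _ => v) ![a, b, c]
  have hinj : Function.Injective φ := by
    rintro (i | i) (j | j) e
    · rw [Subsingleton.elim i j]
    · fin_cases j <;> simp_all [φ]
    · fin_cases i <;> simp_all [φ]
    · fin_cases i <;> fin_cases j <;> simp_all [φ]
  have hadj : ∀ p q, G.Adj (φ p) (φ q) ↔ (completeBipartiteGraph (Fin 1) (Fin 3)).Adj p q := by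
    have nba : ¬ G.Adj b a := fun e => nab e.symm
    have nca : ¬ G.Adj c a := fun e => nac e.symm
    have ncb : ¬ G.Adj c b := fun e => nbc e.symm
    rintro (i | i) (j | j)
    · simp [φ]
    · fin_cases j <;> simp_all [φ]
    · fin_cases i <;> simp_all [φ, G.adj_comm]
    · fin_cases i <;> fin_cases j <;> simp_all [φ]
  exact hcf ⟨⟨⟨φ, hinj⟩, hadj _ _⟩⟩

theorem preCrit [Nontrivial V] (hχ : G.chromaticNumber = (t : ℕ∞)) (hdc : G.IsDoubleCritical)
    (hcf : G.IsClawFree) : PreCrit G (Fin t) where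
  surj f hf := surjective_of_chromaticNumber hχ (Fintype.card_fin t) f hf
  state _ _ hxy := exists_state hχ hdc hxy
  claw _ _ _ _ := adj_of_clawFree hcf
  noniso v := hdc.1.preconnected.exists_adj_of_nontrivial v

theorem adj_of_isDoubleCritical [Fintype V] [Nontrivial V] (ht : t ≤ 8)
    (hχ : G.chromaticNumber = (t : ℕ∞))
    (hdc : G.IsDoubleCritical) (hcf : G.IsClawFree) {a b : V} (hab : a ≠ b) : G.Adj a b := by
  by_contra hn
  have h := preCrit hχ hdc hcf
  -- remove the universal vertices
  let U : Finset V := univ.filter fun u => ∀ w, w ≠ u → G.Adj u w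
  have hU : ∀ u, u ∈ U ↔ ∀ w, w ≠ u → G.Adj u w := by simp [U]
  have hinj : ∀ f : V → Fin t, Proper G f → (U.image f).card = U.card := by
    intro f hf
    apply Finset.card_image_of_injOn
    intro u hu v hv e
    by_contra huv
    exact hf ((hU u).1 hu v (Ne.symm huv)) e
  obtain ⟨w, haw⟩ := h.noniso a
  obtain ⟨f₀, s₀⟩ := h.state haw
  have hUt : U.card ≤ t := by
    rw [← hinj f₀ s₀.proper]
    exact (Finset.card_le_univ _).trans_eq (Fintype.card_fin t)
  have hcrit : Crit (G.induce {v | v ∉ U}) (Fin (t - U.card)) := by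
    refine ⟨⟨?_, ?_, ?_, ?_⟩, ?_⟩
    · intro f hf c
      -- Giving each universal vertex a colour of its own extends `f` to a colouring of `G` with `t`
      -- colours in all.
      obtain ⟨v, hv⟩ := surjective_of_chromaticNumber hχ (C := Fin (t - U.card) ⊕ U)
        (by simp only [Fintype.card_sum, Fintype.card_fin, Fintype.card_coe]; omega)
        (fun v => if hv : v ∈ U then Sum.inr ⟨v, hv⟩ else Sum.inl (f ⟨v, hv⟩))
        (by
          intro u v huv e
          by_cases hu : u ∈ U <;> by_cases hv : v ∈ U <;> simp only [hu, hv, dite_true, dite_false,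
            Sum.inr.injEq, Sum.inl.injEq, Subtype.mk.injEq, reduceCtorEq] at e
          · exact huv.ne e
          · exact hf (u := ⟨u, hu⟩) (v := ⟨v, hv⟩) huv e) (Sum.inl c)
      by_cases hvU : v ∈ U
      · simp [hvU] at hv
      · simp only [hvU, dite_false, Sum.inl.injEq] at hv
        exact ⟨_, hv⟩
    · rintro ⟨x, hx⟩ ⟨y, hy⟩ hxy
      obtain ⟨f, s⟩ := h.state (x := x) (y := y) hxy
      -- Universal vertices use `|U|` colours that occur nowhere else; the other colours are
      -- renamed.
      have hc : Fintype.card {c // c ∈ (U.image f)ᶜ} = Fintype.card (Fin (t - U.card)) := by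
        have := Finset.card_add_card_compl (U.image f)
        rw [hinj f s.proper, Fintype.card_fin] at this
        rw [Fintype.card_coe, Fintype.card_fin]
        omega
      let e := Fintype.equivOfCardEq hc
      have hmem : ∀ v, v ∉ U → f v ∈ (U.image f)ᶜ := by
        intro v hv
        simp only [mem_compl, mem_image, not_exists, not_and]
        intro u hu
        exact s.proper ((hU u).1 hu v fun e => hv (e ▸ hu))
      have he : ∀ u v : {v | v ∉ U}, e ⟨f u, hmem u u.2⟩ = e ⟨f v, hmem v v.2⟩ ↔ f u = f v := by
        intro u v
        rw [e.apply_eq_iff_eq, Subtype.mk.injEq]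
      refine ⟨fun v => e ⟨f v, hmem v v.2⟩, ?_, ?_, ?_, ?_⟩
      · intro u v huv heq
        exact s.proper huv ((he u v).1 heq)
      · intro heq
        exact s.ne (congrArg Subtype.val heq)
      · intro v heq
        exact Subtype.ext (s.left v ((he v ⟨x, hx⟩).1 heq))
      · intro v heq
        exact Subtype.ext (s.right v ((he v ⟨y, hy⟩).1 heq))
    · intro v a b c hva hvb hvc hab hac hbc nab nac
      exact h.claw (v := v.1) (a := a.1) (b := b.1) (c := c.1) hva hvb hvc
        (fun e => hab (Subtype.ext e)) (fun e => hac (Subtype.ext e))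
        (fun e => hbc (Subtype.ext e)) nab nac
    · rintro ⟨w, hw⟩
      have hw' := hw
      simp only [Set.mem_ofPred_eq, hU, not_forall] at hw'
      obtain ⟨x, hxw, nwx⟩ := hw'
      -- The neighbour `z` of `w` misses `x`, so it is not universal and survives the removal.
      obtain ⟨z, hzx, nxz, hwz⟩ := h.exists_edge_outside x w hxw.symm fun e => nwx e.symm
      refine ⟨⟨z, fun hz => ?_⟩, hwz⟩
      exact nxz ((hU z).1 hz x hzx.symm).symm
    · rintro ⟨w, hw⟩
      have hw' := hw
      simp only [Set.mem_ofPred_eq, hU, not_forall] at hw'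
      obtain ⟨x, hxw, nwx⟩ := hw'
      refine ⟨⟨x, fun hx => nwx ((hU x).1 hx w hxw.symm).symm⟩, ?_, nwx⟩
      exact fun e => hxw (congrArg Subtype.val e)
  have haU : a ∉ U := fun ha => hn ((hU a).1 ha b hab.symm)
  have := hcrit.card_gt ⟨a, haU⟩
  rw [Fintype.card_fin] at this
  omega

end DoubleCritical

theorem mainTheorem1 {V : Type*} [Finite V] (G : SimpleGraph V) (t : ℕ) (ht : t ≤ 8)
    (hχ : G.chromaticNumber = (t : ℕ∞)) (hdc : G.IsDoubleCritical) (hcf : G.IsClawFree) :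
    Nonempty (G ≃g (⊤ : SimpleGraph (Fin t))) := by
  have := Fintype.ofFinite V
  have hG : G = ⊤ := by
    ext a b
    rw [SimpleGraph.top_adj]
    refine ⟨fun e => e.ne, fun hab => ?_⟩
    have : Nontrivial V := ⟨a, b, hab⟩
    exact DoubleCritical.adj_of_isDoubleCritical ht hχ hdc hcf hab
  subst hG
  rw [SimpleGraph.chromaticNumber_top, Nat.cast_inj] at hχ
  exact ⟨SimpleGraph.Iso.completeGraph (Fintype.equivFinOfCardEq hχ)⟩
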